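/- For a positive integer $N$ and $f:[1,N]\to\mathbb{R}$ (where $[1,N]=\{1,\dots,N\}$), let $\hat f(\theta)=\sum_{n=1}^{N}f(n)e^{2\pi i n\theta}$. Say that $f$ is \emph{$\eta$-pseudorandom} if $|\hat f(r/N)-\delta_{r,0}N|\le \eta N$ for every $r\in\mathbb{Z}/N\mathbb{Z}$, where $\delta_{r,0}$ is the Kronecker delta; that $f$ satisfies the \emph{$L^q$ extension estimate with constant $K$} if $\left(\int_0^1|\hat f(\theta)|^q\,d\theta\right)^{1/q}\le K N^{1-1/q}$; and that $f$ is \emph{$(\beta,\kappa)$-regular} if $\sum_{(u,v)}f(u)f(v)\ge \kappa N^2$, the sum being over all $u,v\in[1,N]$ with $u\le\beta N$, $v\ge(1-\beta)N$ and $\gcd(v-u,P(\beta^{-1}))=1$, where $P(y)$ is the product of all primes up to $y$. \textbf{Theorem.} Let $0<\delta,\kappa<1$. There is a constant $c=c(\delta,\kappa)>0$, depending only on $\delta$ and $\kappa$, such that the following holds. Let $2<q_1,q_2,q_3<3$ and $K_1,K_2,K_3\in\mathbb{R}$. Then there are $\eta_0>0$ and $N_0$ (depending on $\delta,\kappa$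 and on the $q_i,K_i$) such that for all $0<\eta\le\eta_0$ and all integers $N\ge N_0$, with $N_1=N_2=\lfloor N/2\rfloor$ and $N_3=N$: if $\nu_i,a_i:[1,N_i]\to\mathbb{R}$ $(i=1,2,3)$ are functions such that, with $\alpha_i=\frac1{N_i}\sum_{n=1}^{N_i}a_i(n)$, 1. $0\le a_i(n)\le\nu_i(n)$ for all $1\le n\le N_i$ and $i=1,2,3$; 2. $\alpha_i\ge\delta$ for $i=1,2,3$, and $\tfrac12\big(\min(1,\alpha_1+\alpha_2)+\alpha_2\big)+\alpha_3\ge 1+\delta$; 3. each $\nu_i$ is $\eta$-pseudorandom; 4. each $a_i$ satisfies the $L^{q_i}$ extension estimate with constant $K_i$; 5. $a_1$ is $(\delta/50,\kappa)$-regular; then $$\sum_{\substack{n_1+n_2+n_3=N\\ 1\le n_i\le N_i}}a_1(n_1)a_2(n_2)a_3(n_3)\ge cN^2.$$ Moreover, in the case $\alpha_1=\alpha_2=\alpha_3=\alpha$ the density threshold is $2/5$: for a real number $\alpha$, condition 2 with $\alpha_1=\alpha_2=\alpha_3=\alpha$ holds for some $0<\delta<1$ if and only if $\alpha>2/5$.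 -/

import Mathlib

namespace Transference

/-- The lengths `N₁ = N₂ = ⌊N/2⌋`, `N₃ = N`. -/
def len (N : ℕ) : Fin 3 → ℕ := ![N / 2, N / 2, N]

/-! A function `f : [1, N] → ℝ` is represented by some `f : ℕ → ℝ`; every notion below
only looks at the values `f n` with `1 ≤ n ≤ N`. -/

/-- The average of `f` over `[1, N]`. -/
noncomputable def mean (N : ℕ) (f : ℕ → ℝ) : ℝ :=
  (∑ n ∈ Finset.Icc 1 N, f n) / N

/-- The Fourier transform `f̂(θ) = ∑_{1 ≤ n ≤ N} f(n) e(nθ)`, with `e(x) = exp(2πix)`. -/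
noncomputable def fourierSum (N : ℕ) (f : ℕ → ℝ) (θ : ℝ) : ℂ :=
  ∑ n ∈ Finset.Icc 1 N, (f n : ℂ) * Complex.exp (2 * Real.pi * Complex.I * (n * θ))

/-- `|f̂(r/N) - δ_{r,0} N| ≤ η N` for each `r ∈ ℤ/Nℤ` (represented by `0 ≤ r < N`). -/
def IsPseudorandom (η : ℝ) (N : ℕ) (f : ℕ → ℝ) : Prop :=
  ∀ r : ℕ, r < N →
    ‖fourierSum N f ((r : ℝ) / N) - (if r = 0 then (N : ℂ) else 0)‖ ≤ η * N

/-- The `L^q` norm of the Fourier transform. -/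
noncomputable def fourierLqNorm (q : ℝ) (N : ℕ) (f : ℕ → ℝ) : ℝ :=
  (∫ θ in (0 : ℝ)..1, ‖fourierSum N f θ‖ ^ q) ^ (1 / q)

/-- The `L^q` extension estimate with constant `K`. -/
def LqExtension (q K : ℝ) (N : ℕ) (f : ℕ → ℝ) : Prop :=
  fourierLqNorm q N f ≤ K * (N : ℝ) ^ (1 - 1 / q)

/-- `P(y)`, the product of all primes up to `y`. -/
noncomputable def primeProd (y : ℝ) : ℕ := primorial ⌊y⌋₊

open Classical in
/-- `(β, κ)`-regularity of `f` on `[1, N]`. -/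
def IsRegular (β κ : ℝ) (N : ℕ) (f : ℕ → ℝ) : Prop :=
  κ * (N : ℝ) ^ 2 ≤
    ∑ p ∈ (Finset.Icc 1 N ×ˢ Finset.Icc 1 N).filter
        (fun p : ℕ × ℕ => (p.1 : ℝ) ≤ β * N ∧ (1 - β) * N ≤ (p.2 : ℝ) ∧
          Int.gcd ((p.2 : ℤ) - (p.1 : ℤ)) (primeProd β⁻¹ : ℤ) = 1),
      f p.1 * f p.2

/-- The mean condition on the averages `(α₁, α₂, α₃)`. -/
def MeanCondition (δ : ℝ) (α : Fin 3 → ℝ) : Prop :=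
  (∀ i, δ ≤ α i) ∧ 1 + δ ≤ 1 / 2 * (min 1 (α 0 + α 1) + α 1) + α 2

/-- The sum of `a₁(n₁) a₂(n₂) a₃(n₃)` over `n₁ + n₂ + n₃ = N` with `1 ≤ nᵢ ≤ Nᵢ`. -/
noncomputable def solutionSum (N : ℕ) (a : Fin 3 → ℕ → ℝ) : ℝ :=
  ∑ n ∈ (Fintype.piFinset fun i => Finset.Icc 1 (len N i)).filter
      (fun n : Fin 3 → ℕ => n 0 + n 1 + n 2 = N),
    a 0 (n 0) * a 1 (n 1) * a 2 (n 2)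

end Transference

namespace Transference
open Finset

/-! The proof transfers the problem from weighted functions to dense sets of integers. Each `a i`
lies below a pseudorandom majorant and its Fourier transform has an `L^q` bound with `q < 3`, so its
large frequencies fit into boundedly many intervals of length `1/N`. Averaging over differences of a
Bohr-type set of multiples of `P(50/δ)` barely changes the transform at those frequencies, while
pseudorandomness keeps the average below `1 + ε` (`exists_smooth`). Replacing all three functions by
their averages changes the number of solutions by a small multiple of `N²`, since the triple sum is
controlled by third moments (`abs_tripleSum_smooth_sub_le`). The sets where the averages are at
least `ε` have nearly the original densities, and regularity survives in residue classes modulo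
`P(50/δ)`.

In the dense case (`exists_le_sum_rep`) there are `A₁, A₂ ⊆ [1, N/2]` and `T = N - A₃`. If few sums
from `A₁ + A₂` land in `T`, regularity gives `u, v ∈ A₁` near opposite ends of the interval, with `u
+ A₂` and `v + A₂` almost disjoint from `T` and with no prime up to `50/δ` dividing `ℓ = v - u`. All
proper subgroups of `ℤ/ℓ` are then small, so Pollard's theorem (`mul_min_le_sum_min_rep`) produces
about `min(ℓ, |A₁| + |A₂|)` popular residues. Each popular residue gives an integer that is popular
or equals some `u + b`, and almost every `b ∈ A₂` gives `v + b`; these integers are distinct and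
avoid the unpopular part of `T`, which is almost all of `T`. Fitting everything into `[0, N]`
contradicts the mean condition.

The final constant is built from `ε` and the dense bound, both fixed before the `q i` and `K i`,
which only influence how small `η` must be. -/

/-- The number of representations `x = a + b` with `a ∈ A`, `b ∈ B`. -/
def rep {G : Type*} [AddCommGroup G] [DecidableEq G] (A B : Finset G) (x : G) : ℕ :=
  #{a ∈ A | x - a ∈ B}

/-! ### Pollard's theorem in finite abelian groups -/

section rep
variable {G : Type*} [AddCommGroup G] [DecidableEq G]

lemma rep_comm (A B : Finset G) (x : G) : rep A B x = rep B A x := by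
  refine Finset.card_bij' (fun a _ => x - a) (fun a _ => x - a) ?_ ?_ ?_ ?_ <;>
    simp +contextual [and_comm]

lemma rep_union_left {A A' : Finset G} (h : Disjoint A A') (B : Finset G) (x : G) :
    rep (A ∪ A') B x = rep A B x + rep A' B x := by
  unfold rep
  rw [filter_union, card_union_of_disjoint (disjoint_filter_filter h)]

lemma rep_union_right (A : Finset G) {B B' : Finset G} (h : Disjoint B B') (x : G) :
    rep A (B ∪ B') x = rep A B x + rep A B' x := by
  rw [rep_comm, rep_union_left h, rep_comm B, rep_comm B']

lemma rep_le_right (A B : Finset G) (x : G) : rep A B x ≤ #B := by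
  rw [rep_comm]; exact card_filter_le _ _

lemma rep_mono_right (A : Finset G) {B B' : Finset G} (h : B ⊆ B') (x : G) :
    rep A B x ≤ rep A B' x :=
  card_le_card fun a ha => by
    simp only [mem_filter] at ha ⊢
    exact ⟨ha.1, h ha.2⟩

/-- This identity drives the induction for Pollard's theorem. Cutting both sets along `A ∩ B`, the
left side differs from the right only in that `(B \ A) + (A ∩ B)` appears in place of `(A ∩ B) + (B
\ A)`, and these give the same counts by commutativity. -/
lemma rep_transform (A B : Finset G) (x : G) :
    rep (A ∪ B) (A ∩ B) x + rep (A \ B) (B \ A) x = rep A B x := by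
  have hB : B = A ∩ B ∪ B \ A := by rw [inter_comm, union_comm, sdiff_union_inter]
  have hA : A = A ∩ B ∪ A \ B := by rw [union_comm, sdiff_union_inter]
  have hd : Disjoint (A ∩ B) (B \ A) :=
    disjoint_sdiff.mono_left inter_subset_left
  have hd' : Disjoint (A ∩ B) (A \ B) :=
    disjoint_sdiff.mono_left inter_subset_right
  have h1 : rep (A ∪ B) (A ∩ B) x = rep A (A ∩ B) x + rep (B \ A) (A ∩ B) x := by
    rw [← rep_union_left disjoint_sdiff, union_sdiff_self_eq_union]
  have h2 : rep A B x = rep A (A ∩ B) x + rep A (B \ A) x := by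
    conv_lhs => rw [hB]
    rw [rep_union_right _ hd]
  have h3 : rep A (B \ A) x = rep (A ∩ B) (B \ A) x + rep (A \ B) (B \ A) x := by
    conv_lhs => rw [hA]
    rw [← rep_union_left hd']
    rw [← hA]
  rw [h1, h2, h3, rep_comm (B \ A)]; ring

lemma rep_image_add (A B : Finset G) (e x : G) :
    rep (A.image (· + e)) B x = rep A B (x - e) := by
  unfold rep
  rw [filter_image, card_image_of_injective _ (add_left_injective e)]
  congr 1
  ext a
  simp [sub_sub, add_comm]

lemma sum_rep [Fintype G] (A B : Finset G) : ∑ x, rep A B x = #A * #B := by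
  unfold rep
  simp_rw [card_filter]
  rw [sum_comm]
  simp_rw [← card_filter]
  rw [← smul_eq_mul, ← sum_const]
  refine sum_congr rfl fun a _ => ?_
  refine Finset.card_bij' (fun x _ => x - a) (fun b _ => b + a) ?_ ?_ ?_ ?_ <;> simp

/-- If no translate of `A` meets `B` in a nonempty proper subset of `B`, then `A` is everything or
`B` lies in a coset of a proper subgroup. -/
lemma eq_univ_or_card_le_of_translates [Fintype G] {D : ℕ}
    (hD : ∀ H : AddSubgroup G, H ≠ ⊤ → Nat.card H ≤ D) {A B : Finset G} (hA : A.Nonempty)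
    (h : ∀ e, (A.image (· + e) ∩ B).Nonempty → B ⊆ A.image (· + e)) :
    A = univ ∨ #B ≤ D := by
  classical
  rcases B.eq_empty_or_nonempty with rfl | ⟨b₀, hb₀⟩
  · simp
  set H : AddSubgroup G := AddSubgroup.closure ((fun b => b - b₀) '' (B : Set G))
  have key : ∀ g ∈ H, ∀ a, a ∈ A ↔ a + g ∈ A := by
    intro g hg
    induction hg using AddSubgroup.closure_induction with
    | mem g hg =>
      obtain ⟨b, hb, rfl⟩ := hg
      -- The translate of `A` by `b₁ - a` contains `b₁`, so it meets `B` and must contain `b₂`.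
      -- Hence `A` is stable under all differences of `B`.
      have aux : ∀ b₁ ∈ B, ∀ b₂ ∈ B, ∀ a ∈ A, a + (b₂ - b₁) ∈ A := by
        intro b₁ h₁ b₂ h₂ a ha
        have := h (b₁ - a) ⟨b₁, by simp [ha, h₁]⟩ h₂
        obtain ⟨a', ha', he⟩ := mem_image.1 this
        have : a + (b₂ - b₁) = a' := by rw [← he]; abel
        rwa [this]
      intro a
      refine ⟨aux b₀ hb₀ b hb a, fun ha => ?_⟩
      have := aux b hb b₀ hb₀ _ ha
      have h0 : a + (b - b₀) + (b₀ - b) = a := by abel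
      rwa [h0] at this
    | zero => simp
    | add x y _ _ hx hy => intro a; rw [hx, hy, add_assoc]
    | neg x _ hx => intro a; rw [hx (a + -x)]; simp
  by_cases hH : H = ⊤
  · left
    obtain ⟨a, ha⟩ := hA
    ext x
    simp only [mem_univ, iff_true]
    have := (key (x - a) (by rw [hH]; trivial) a).1 ha
    simpa using this
  · right
    refine le_trans ?_ (hD H hH)
    rw [← card_image_of_injective B (sub_left_injective (b := b₀)), ← Set.ncard_coe_finset,
      ← SetLike.coe_sort_coe, Nat.card_coe_set_eq]
    refine Set.ncard_le_ncard ?_ (Set.toFinite _)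
    rw [coe_image]
    exact AddSubgroup.subset_closure

/-- **Pollard's theorem** in a finite abelian group all of whose proper subgroups have at most `D`
elements. -/
theorem mul_min_le_sum_min_rep [Fintype G] {D : ℕ}
    (hD : ∀ H : AddSubgroup G, H ≠ ⊤ → Nat.card H ≤ D) (A B : Finset G) (t : ℕ)
    (htA : t ≤ #A) (htB : t ≤ #B) :
    (t : ℤ) * min (Fintype.card G : ℤ) (#A + #B - t - D) ≤ ∑ x, (min t (rep A B x) : ℕ) := by
  induction hn : #B using Nat.strong_induction_on generalizing A B t with
  | _ n ih =>
  subst hn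
  rcases Nat.eq_zero_or_pos t with rfl | ht
  · simp
  by_cases hB : #B ≤ D
  -- Shrinking `B` to `t` elements makes the truncation at `t` vacuous and leaves `t * #A`, which
  -- suffices because `#B - D ≤ 0`.
  · obtain ⟨B₀, hB₀, hc⟩ := exists_subset_card_eq htB
    have h1 : #A * t ≤ ∑ x, min t (rep A B x) := by
      rw [← hc, ← sum_rep]
      exact sum_le_sum fun x _ => le_min (rep_le_right _ _ _) (rep_mono_right A hB₀ x)
    calc (t : ℤ) * min (Fintype.card G : ℤ) (#A + #B - t - D)
        ≤ t * #A := by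
          refine mul_le_mul_of_nonneg_left ((min_le_right _ _).trans ?_) (by positivity)
          have : (#B : ℤ) ≤ D := by exact_mod_cast hB
          linarith [(Nat.cast_nonneg t : (0 : ℤ) ≤ t)]
      _ ≤ _ := by rw [mul_comm]; exact_mod_cast h1
  have hA0 : A.Nonempty := card_pos.1 (ht.trans_le htA)
  by_cases hU : A = univ
  · have h1 : ∀ x, rep A B x = #B := fun x => by
      rw [rep_comm]; simp [rep, hU]
    simp only [h1, min_eq_left htB, sum_const, card_univ, nsmul_eq_mul]
    push_cast
    rw [mul_comm]
    exact mul_le_mul_of_nonneg_right (min_le_left _ _) (by positivity)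
  -- After this translation `A ∩ B` is a nonempty proper subset of `B`, so both `A ∩ B` and `B \ A`
  -- are smaller than `B` and available to the induction.
  obtain ⟨e, he, hne⟩ : ∃ e, (A.image (· + e) ∩ B).Nonempty ∧ ¬ B ⊆ A.image (· + e) := by
    by_contra! hcon
    exact (eq_univ_or_card_le_of_translates hD hA0 hcon).elim hU hB
  have hsum : ∑ x, min t (rep A B x) = ∑ x, min t (rep (A.image (· + e)) B x) := by
    simp_rw [rep_image_add]
    exact (Equiv.sum_comp (Equiv.subRight e) fun x => min t (rep A B x)).symm
  have hcA : #(A.image (· + e)) = #A := card_image_of_injective _ (add_left_injective e)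
  rw [hsum, ← hcA]
  rw [← hcA] at htA
  generalize A.image (· + e) = A at *
  have hI : #(A ∩ B) < #B := by
    refine card_lt_card ((ssubset_iff_of_subset inter_subset_right).2 ?_)
    obtain ⟨b, hb, hb'⟩ := not_subset.1 hne
    exact ⟨b, hb, fun h => hb' (mem_inter.1 h).1⟩
  have hI0 : 0 < #(A ∩ B) := card_pos.2 he
  have hUI := card_union_add_card_inter A B
  rcases le_or_gt t #(A ∩ B) with hle | hgt
  · have := ih _ hI (A ∪ B) (A ∩ B) t (by omega) hle rfl
    have e1 : (#(A ∪ B) : ℤ) + #(A ∩ B) = #A + #B := by exact_mod_cast hUI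
    rw [e1] at this
    refine this.trans ?_
    refine Nat.cast_le.2 (sum_le_sum fun x _ => min_le_min_left _ ?_)
    rw [← rep_transform A B x]; omega
  · have hA' := card_sdiff_add_card_inter A B
    have hB' := card_sdiff_add_card_inter B A
    rw [inter_comm] at hB'
    have h2 := ih #(B \ A) (by omega) (A \ B) (B \ A) (t - #(A ∩ B)) (by omega) (by omega) rfl
    -- The pair `(A ∪ B, A ∩ B)` never exceeds `#(A ∩ B) < t` representations, so it is counted in
    -- full and only the pair of differences is truncated, at the remaining level.
    have h1 : ∑ x, rep (A ∪ B) (A ∩ B) x + ∑ x, min (t - #(A ∩ B)) (rep (A \ B) (B \ A) x)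
        ≤ ∑ x, min t (rep A B x) := by
      rw [← sum_add_distrib]
      refine sum_le_sum fun x _ => ?_
      have := rep_transform A B x
      have := rep_le_right (A ∪ B) (A ∩ B) x
      omega
    rw [sum_rep] at h1
    have h1' : (#(A ∪ B) : ℤ) * #(A ∩ B) +
        ((∑ x, min (t - #(A ∩ B)) (rep (A \ B) (B \ A) x) : ℕ) : ℤ)
          ≤ ((∑ x, min t (rep A B x) : ℕ) : ℤ) := by exact_mod_cast h1
    refine le_trans ?_ h1'
    refine le_trans ?_ (add_le_add_right h2 _)
    have e1 : (#(A ∪ B) : ℤ) = #A + #B - #(A ∩ B) := by omega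
    have e2 : (#(A \ B) : ℤ) = #A - #(A ∩ B) := by omega
    have e3 : (#(B \ A) : ℤ) = #B - #(A ∩ B) := by omega
    have e4 : ((t - #(A ∩ B) : ℕ) : ℤ) = t - #(A ∩ B) := by omega
    have hcard : (#(A ∪ B) : ℤ) ≤ Fintype.card G := by exact_mod_cast card_le_univ _
    rw [e2, e3, e4, e1]
    rw [e1] at hcard
    have hI0' : (0 : ℤ) < #(A ∩ B) := by exact_mod_cast hI0
    have hgt' : (#(A ∩ B) : ℤ) < t := by exact_mod_cast hgt
    have hD0 : (0 : ℤ) ≤ D := by positivity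
    have hBn : ¬ (#B : ℤ) ≤ D := by exact_mod_cast hB
    generalize (#(A ∩ B) : ℤ) = i at *
    generalize (Fintype.card G : ℤ) = g at *
    generalize (#A : ℤ) = a at *
    generalize (#B : ℤ) = b at *
    -- The minimum is attained by its second entry since `#(A ∪ B) ≤ g`. After this the two bounds
    -- differ by exactly `i * D ≥ 0`.
    have hm : min g (a - i + (b - i) - (t - i) - D) = a + b - t - i - D := by
      rw [min_eq_right (by linarith)]; ring
    rw [hm]
    calc (t : ℤ) * min g (a + b - t - D) ≤ t * (a + b - t - D) :=
          mul_le_mul_of_nonneg_left (min_le_right _ _) (by linarith)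
      _ ≤ _ := by nlinarith

end rep

/-! ### The dense case: popular residues and sums of integers -/

/-- The index of a proper subgroup has a prime factor dividing `ℓ`, so it exceeds `β⁻¹`. This
supplies the bound `D` in Pollard's theorem. -/
lemma card_addSubgroup_le_of_prime_lt {β : ℝ} (hβ : 0 < β) {ℓ : ℕ} [NeZero ℓ]
    (hp : ∀ p : ℕ, p.Prime → p ∣ ℓ → β⁻¹ < p) (H : AddSubgroup (ZMod ℓ)) (hH : H ≠ ⊤) :
    Nat.card H ≤ ⌊β * ℓ⌋₊ := by
  have h1 := H.card_mul_index
  rw [Nat.card_eq_fintype_card (α := ZMod ℓ), ZMod.card] at h1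
  have hi : H.index ≠ 1 := fun h => hH (AddSubgroup.index_eq_one.1 h)
  have hpr := Nat.minFac_prime hi
  have hdvd : H.index.minFac ∣ ℓ := (Nat.minFac_dvd _).trans ⟨_, by rw [mul_comm, h1]⟩
  have hlt := hp _ hpr hdvd
  have hi0 : 0 < H.index := Nat.pos_of_ne_zero fun h => by
    rw [h, mul_zero] at h1; exact NeZero.ne ℓ h1.symm
  have hle : (H.index.minFac : ℝ) ≤ H.index := by exact_mod_cast Nat.minFac_le hi0
  refine Nat.le_floor ?_
  have h2 : (Nat.card H : ℝ) * H.index = ℓ := by exact_mod_cast h1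
  rw [← h2]
  have : 1 ≤ β * H.index := by
    rw [← mul_inv_cancel₀ hβ.ne']
    exact mul_le_mul_of_nonneg_left (hlt.le.trans hle) hβ.le
  nlinarith [(Nat.cast_nonneg (Nat.card H) : (0 : ℝ) ≤ Nat.card H)]

open Classical in
/-- Lower bound for the number of elements with many representations. -/
lemma mul_min_le_card_popular {G : Type*} [AddCommGroup G] [Fintype G] [DecidableEq G] {D : ℕ}
    (hD : ∀ H : AddSubgroup G, H ≠ ⊤ → Nat.card H ≤ D) (A B : Finset G) (t : ℕ)
    (htA : t ≤ #A) (htB : t ≤ #B) {s : ℝ} (hs : 0 ≤ s) :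
    (t : ℝ) * min (Fintype.card G : ℝ) (#A + #B - t - D) ≤
      t * #{x | s ≤ rep A B x} + s * Fintype.card G := by
  have h := mul_min_le_sum_min_rep hD A B t htA htB
  have h' : (t : ℝ) * min (Fintype.card G : ℝ) (#A + #B - t - D) ≤
      ∑ x, (min t (rep A B x) : ℕ) := by exact_mod_cast h
  refine h'.trans ?_
  have : (t : ℝ) * #{x | s ≤ rep A B x} + s * Fintype.card G
      = ∑ x : G, ((if s ≤ rep A B x then (t : ℝ) else 0) + s) := by
    rw [sum_add_distrib, ← sum_filter, sum_const, sum_const, card_univ, nsmul_eq_mul, nsmul_eq_mul]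
    ring
  rw [this]
  push_cast
  refine sum_le_sum fun x _ => ?_
  split_ifs with hx
  · linarith [min_le_left (t : ℝ) (rep A B x)]
  · linarith [min_le_right (t : ℝ) (rep A B x)]

lemma eq_or_eq_add_of_intCast_eq {ℓ : ℕ} {a y : ℤ} (h : (a : ZMod ℓ) = y) (h1 : y - ℓ < a)
    (h2 : a < y + 2 * ℓ) : a = y ∨ a = y + ℓ := by
  rw [ZMod.intCast_eq_intCast_iff_dvd_sub] at h
  obtain ⟨k, hk⟩ := h
  have hℓ : (0 : ℤ) < ℓ := by omega
  have hk1 : k < 1 := by nlinarith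
  have hk2 : -2 < k := by nlinarith
  have : k = 0 ∨ k = -1 := by omega
  rcases this with rfl | rfl
  · left; linarith
  · right; linarith

/-- All sums `a + b` lie in `[u + 1, u + 2ℓ - 1]`, a window in which the class of `y` has no members
other than `y` and `y + ℓ`. -/
lemma rep_intCast_le {ℓ : ℕ} {A B : Finset ℤ} {u y : ℤ} (hA : A ⊆ Ico u (u + ℓ))
    (hB : B ⊆ Icc 1 (ℓ : ℤ)) (hy : y ∈ Icc (u + 1) (u + ℓ)) :
    rep (A.image (Int.cast : ℤ → ZMod ℓ)) (B.image Int.cast) y ≤ rep A B y + rep A B (y + ℓ) := by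
  unfold rep
  rw [filter_image]
  refine card_image_le.trans ((card_le_card ?_).trans (card_union_le _ _))
  intro a ha
  simp only [mem_filter, mem_image, mem_union] at ha ⊢
  obtain ⟨ha, b, hb, hab⟩ := ha
  have h1 := mem_Ico.1 (hA ha)
  have h2 := mem_Icc.1 (hB hb)
  have h3 := mem_Icc.1 hy
  have hc : ((a + b : ℤ) : ZMod ℓ) = y := by push_cast; rw [hab]; ring
  rcases eq_or_eq_add_of_intCast_eq hc (by omega) (by omega) with h | h
  · left; exact ⟨ha, by rwa [← h, add_sub_cancel_left]⟩
  · right; exact ⟨ha, by rwa [← h, add_sub_cancel_left]⟩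

lemma exists_intCast_eq_mem_Icc {ℓ : ℕ} [NeZero ℓ] (u : ℤ) (x : ZMod ℓ) :
    ∃ y ∈ Icc (u + 1) (u + ℓ), (y : ZMod ℓ) = x := by
  refine ⟨u + 1 + ((x - ((u + 1 : ℤ) : ZMod ℓ)).val : ℤ), ?_, ?_⟩
  · have := ZMod.val_lt (x - ((u + 1 : ℤ) : ZMod ℓ))
    rw [mem_Icc]; omega
  · push_cast
    rw [ZMod.natCast_val, ZMod.cast_id]; ring

lemma card_image_intCast {ℓ : ℕ} {A : Finset ℤ} {u : ℤ} (hA : A ⊆ Ico u (u + ℓ)) :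
    #(A.image (Int.cast : ℤ → ZMod ℓ)) = #A := by
  refine card_image_of_injOn fun a ha b hb hab => ?_
  have h1 := mem_Ico.1 (hA ha)
  have h2 := mem_Ico.1 (hA hb)
  rcases eq_or_eq_add_of_intCast_eq hab (by omega) (by omega) with h | h <;> omega

open Classical in
/-- The double counting in the Lev–Smeliansky argument: the unpopular part of `T`, the set `A₂`
and the set of popular residues modulo `ℓ = v - u` fit together into `[0, N]`. -/
lemma card_unpopular_add_card_add_card_popular_le {L N : ℤ} {A₁ A₂ T : Finset ℤ} {u : ℤ} {ℓ : ℕ}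
    [NeZero ℓ] {s τ : ℝ} (hT : T ⊆ Icc 0 N) (hLN : 2 * L ≤ N) (hu : 1 ≤ u) (hv : u + ℓ ≤ L)
    (hTu : (#{b ∈ A₂ | u + b ∈ T} : ℝ) ≤ τ) (hTv : (#{b ∈ A₂ | u + ℓ + b ∈ T} : ℝ) ≤ τ) :
    (#{n ∈ T | (rep A₁ A₂ n : ℝ) < s} : ℝ) + #(A₂ ∩ Icc 1 (ℓ : ℤ)) +
      #{x : ZMod ℓ | 2 * s ≤ rep ((A₁ ∩ Ico u (u + ℓ)).image (Int.cast : ℤ → ZMod ℓ))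
        ((A₂ ∩ Icc 1 (ℓ : ℤ)).image Int.cast) x} ≤ N + 1 + 2 * τ := by
  set S := {n ∈ T | (rep A₁ A₂ n : ℝ) < s} with hS
  set B := A₂ ∩ Icc 1 (ℓ : ℤ) with hB
  set P := ({x : ZMod ℓ | 2 * s ≤ rep ((A₁ ∩ Ico u (u + ℓ)).image (Int.cast : ℤ → ZMod ℓ))
        (B.image Int.cast) x} : Finset (ZMod ℓ)) with hP
  set V := {b ∈ B | u + b ∉ T ∧ u + ℓ + b ∉ T} with hV
  have hℓ : 0 < (ℓ : ℤ) := by exact_mod_cast Nat.pos_of_ne_zero (NeZero.ne ℓ)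
  have hBI : ∀ b ∈ B, 1 ≤ b ∧ b ≤ ℓ := fun b hb => mem_Icc.1 (mem_inter.1 hb).2
  have hVB : (#B : ℝ) ≤ #V + 2 * τ := by
    have : B ⊆ V ∪ ({b ∈ A₂ | u + b ∈ T} ∪ {b ∈ A₂ | u + ℓ + b ∈ T}) := by
      intro b hb
      have := (mem_inter.1 hb).1
      simp only [hV, mem_union, mem_filter]
      tauto
    have h1 := (card_le_card this).trans ((card_union_le _ _).trans
      (Nat.add_le_add_left (card_union_le _ _) _))
    have h2 : (#B : ℝ) ≤ #V + (#{b ∈ A₂ | u + b ∈ T} + #{b ∈ A₂ | u + ℓ + b ∈ T}) := by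
      exact_mod_cast h1
    linarith
  -- Each popular residue gets a representative outside both `S` and `u + ℓ + V`. If it is the class
  -- of some `u + b` with `b ∈ V`, that integer is not in `T`. Otherwise one of the two lifts has at
  -- least `s` representations, and it cannot lie in `u + ℓ + V` without its class being that of an
  -- element of `u + V`.
  have hex : ∀ x ∈ P, ∃ n ∈ Icc 0 N, n ∉ S ∧ (n : ZMod ℓ) = x ∧ ∀ b ∈ V, n ≠ u + ℓ + b := by
    intro x hx
    by_cases hxV : ∃ b ∈ V, ((u + b : ℤ) : ZMod ℓ) = x
    · obtain ⟨b, hb, hbx⟩ := hxV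
      have hb' := mem_filter.1 hb
      have hb1 := hBI b hb'.1
      refine ⟨u + b, mem_Icc.2 (by omega), fun h => hb'.2.1 (mem_filter.1 h).1, hbx, ?_⟩
      intro b' hb'
      have := hBI b' (mem_filter.1 hb').1
      omega
    · obtain ⟨y, hy, rfl⟩ := exists_intCast_eq_mem_Icc u x
      have h1 := rep_intCast_le (A := A₁ ∩ Ico u (u + ℓ)) inter_subset_right
        (B := B) inter_subset_right hy
      have h2 : 2 * s ≤ _ := (mem_filter.1 hx).2
      have hmono : ∀ z, rep (A₁ ∩ Ico u (u + ℓ)) B z ≤ rep A₁ A₂ z := fun z =>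
        (rep_mono_right _ inter_subset_left z).trans
          (by rw [rep_comm, rep_comm A₁]; exact rep_mono_right _ inter_subset_left z)
      have h3 : 2 * s ≤ rep A₁ A₂ y + rep A₁ A₂ (y + ℓ) := by
        refine h2.trans ?_
        exact_mod_cast h1.trans (add_le_add (hmono _) (hmono _))
      have hy' := mem_Icc.1 hy
      have hbad : ∀ n : ℤ, (n : ZMod ℓ) = y → ∀ b ∈ V, n ≠ u + ℓ + b := by
        rintro n hn b hb rfl
        refine hxV ⟨b, hb, ?_⟩
        rw [← hn]; push_cast; simp
      rcases le_or_gt s (rep A₁ A₂ y) with h | h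
      · exact ⟨y, mem_Icc.2 (by omega), fun hm => absurd (mem_filter.1 hm).2 (not_lt.2 h), rfl,
          hbad y rfl⟩
      · have h4 : s ≤ rep A₁ A₂ (y + ℓ) := by linarith
        have h5 : ((y + ℓ : ℤ) : ZMod ℓ) = y := by push_cast; simp
        exact ⟨y + ℓ, mem_Icc.2 (by omega), fun hm => absurd (mem_filter.1 hm).2 (not_lt.2 h4), h5,
          hbad _ h5⟩
  choose! f hf1 hf2 hf3 hf4 using hex
  have hcard : #S + (#V + #P) ≤ #(Icc 0 N) := by
    have e1 : #(V.image (u + ℓ + ·)) = #V := card_image_of_injective _ (add_right_injective _)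
    have e2 : #(P.image f) = #P := card_image_of_injOn fun x hx y hy h => by
      rw [← hf3 x hx, ← hf3 y hy, h]
    have d1 : Disjoint (V.image (u + ℓ + ·)) (P.image f) := by
      rw [disjoint_left]
      intro z hz hz'
      obtain ⟨b, hb, rfl⟩ := mem_image.1 hz
      obtain ⟨x, hx, h⟩ := mem_image.1 hz'
      exact hf4 x hx b hb h
    have d2 : Disjoint S (V.image (u + ℓ + ·) ∪ P.image f) := by
      rw [disjoint_right]
      intro z hz
      rcases mem_union.1 hz with hz | hz
      · obtain ⟨b, hb, rfl⟩ := mem_image.1 hz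
        exact fun h => (mem_filter.1 hb).2.2 (mem_filter.1 h).1
      · obtain ⟨x, hx, rfl⟩ := mem_image.1 hz
        exact hf2 x hx
    rw [← e1, ← e2, ← card_union_of_disjoint d1, ← card_union_of_disjoint d2]
    refine card_le_card (union_subset ((filter_subset _ _).trans hT) (union_subset ?_ ?_))
    · intro z hz
      obtain ⟨b, hb, rfl⟩ := mem_image.1 hz
      have := hBI b (mem_filter.1 hb).1
      exact mem_Icc.2 (by omega)
    · intro z hz
      obtain ⟨x, hx, rfl⟩ := mem_image.1 hz
      exact hf1 x hx
  rw [Int.card_Icc] at hcard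
  have h0 : ((N + 1 - 0).toNat : ℝ) = N + 1 := by
    have : ((N + 1 - 0).toNat : ℤ) = N + 1 := by omega
    exact_mod_cast this
  have : (#S : ℝ) + (#V + #P) ≤ N + 1 := by rw [← h0]; exact_mod_cast hcard
  linarith

/-- A prime up to `β⁻¹` divides the modulus of the congruence, so if it divided `ℓ` it would divide
the gcd as well. -/
lemma inv_lt_prime_of_dvd {β : ℝ} {b b' ℓ : ℤ} (hb : Int.gcd (b' - b) (primeProd β⁻¹) = 1)
    (hℓ : ℓ ≡ b' - b [ZMOD primeProd β⁻¹]) {p : ℕ} (hp : p.Prime) (hpl : (p : ℤ) ∣ ℓ) :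
    β⁻¹ < p := by
  by_contra! hle
  have h1 : p ∣ primeProd β⁻¹ := by
    exact hp.dvd_primorial_iff.2 (Nat.le_floor hle)
  have h2 : (p : ℤ) ∣ b' - b := by
    have := (hℓ.of_dvd (Int.natCast_dvd_natCast.2 h1)).dvd
    have h3 := dvd_add this hpl
    simpa using h3
  have h3 : (p : ℤ) ∣ ((Int.gcd (b' - b) (primeProd β⁻¹) : ℕ) : ℤ) :=
    Int.dvd_coe_gcd h2 (Int.natCast_dvd_natCast.2 h1)
  rw [hb] at h3
  exact hp.one_lt.ne' (by exact_mod_cast Int.eq_one_of_dvd_one (by positivity) h3)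

/-- A set of `u` that contributes few representations contains a `u` contributing few. -/
lemma exists_card_filter_add_mem_le {A₁ A₂ T U : Finset ℤ} {σ τ : ℝ} (hU : U ⊆ A₁)
    (hσ : σ < #U * τ) (h : ((∑ n ∈ T, rep A₁ A₂ n : ℕ) : ℝ) ≤ σ) :
    ∃ u ∈ U, (#{b ∈ A₂ | u + b ∈ T} : ℝ) ≤ τ := by
  by_contra! hcon
  have h1 : ∑ u ∈ U, #{b ∈ A₂ | u + b ∈ T} ≤ ∑ n ∈ T, rep A₁ A₂ n := by
    unfold rep
    simp_rw [card_filter]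
    rw [sum_comm (s := T)]
    refine (sum_le_sum_of_subset (M := ℕ) hU).trans (sum_le_sum fun u _ => ?_)
    rw [← card_filter, ← card_filter]
    refine card_le_card_of_injOn (u + ·) ?_ (add_right_injective u).injOn
    intro b hb
    simp only [coe_filter, Set.mem_ofPred_eq] at hb ⊢
    exact ⟨hb.2, by simpa using hb.1⟩
  have h2 : (#U : ℝ) * τ ≤ ((∑ u ∈ U, #{b ∈ A₂ | u + b ∈ T} : ℕ) : ℝ) := by
    push_cast
    rw [← nsmul_eq_mul, ← sum_const]
    exact sum_le_sum fun u hu => (hcon u hu).le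
  have h3 : ((∑ u ∈ U, #{b ∈ A₂ | u + b ∈ T} : ℕ) : ℝ) ≤ ((∑ n ∈ T, rep A₁ A₂ n : ℕ) : ℝ) := by
    exact_mod_cast h1
  linarith

/-- Markov's inequality: a small total over `T` forces almost all of `T` to be unpopular. -/
lemma card_filter_rep_ge_mul_le {A₁ A₂ T : Finset ℤ} {σ s : ℝ}
    (h : ((∑ n ∈ T, rep A₁ A₂ n : ℕ) : ℝ) ≤ σ) :
    (#T - #{n ∈ T | (rep A₁ A₂ n : ℝ) < s} : ℝ) * s ≤ σ := by
  have h0 := card_filter_add_card_filter_not (s := T) (fun n => (rep A₁ A₂ n : ℝ) < s)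
  have h1 : (#T : ℝ) - #{n ∈ T | (rep A₁ A₂ n : ℝ) < s} = #{n ∈ T | ¬ (rep A₁ A₂ n : ℝ) < s} := by
    rw [← h0]; push_cast; ring
  rw [h1]
  refine le_trans ?_ h
  push_cast
  rw [← nsmul_eq_mul, ← sum_const]
  refine (sum_le_sum fun n hn => not_lt.1 (mem_filter.1 hn).2).trans
    (sum_le_sum_of_subset_of_nonneg (filter_subset _ _) fun _ _ _ => by positivity)

/-- The dense case: sets whose densities satisfy the mean condition (up to a small error), the
first of which has many elements near both ends of the interval in suitable residue classes. -/
theorem exists_le_sum_rep {δ κ : ℝ} (hδ : 0 < δ) (hδ1 : δ < 1) (hκ : 0 < κ) :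
    ∃ c : ℝ, 0 < c ∧ ∃ N₀ : ℕ, ∀ N : ℕ, N₀ ≤ N → ∀ α : Fin 3 → ℝ, MeanCondition δ α →
      (∀ i, α i ≤ 2) → ∀ A₁ A₂ T : Finset ℤ,
      A₁ ⊆ Icc 1 ((N / 2 : ℕ) : ℤ) → A₂ ⊆ Icc 1 ((N / 2 : ℕ) : ℤ) → T ⊆ Icc 0 (N : ℤ) →
      α 0 * (N / 2 : ℕ) - δ / 1000 * N ≤ #A₁ → α 1 * (N / 2 : ℕ) - δ / 1000 * N ≤ #A₂ →
      α 2 * N - δ / 1000 * N ≤ #T →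
      ∀ b b' : ℤ, Int.gcd (b' - b) (primeProd (δ / 50)⁻¹) = 1 →
      (κ * N ≤ #{u ∈ A₁ | ((u : ℤ) : ℝ) ≤ δ / 50 * (N / 2 : ℕ) + δ / 1000 * N ∧
        u ≡ b [ZMOD primeProd (δ / 50)⁻¹]}) →
      (κ * N ≤ #{v ∈ A₁ | (1 - δ / 50) * (N / 2 : ℕ) - δ / 1000 * N ≤ ((v : ℤ) : ℝ) ∧
        v ≡ b' [ZMOD primeProd (δ / 50)⁻¹]}) →
      c * (N : ℝ) ^ 2 ≤ ((∑ n ∈ T, rep A₁ A₂ n : ℕ) : ℝ) := by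
  set τ : ℝ := δ / 100 with hτ
  set s : ℝ := δ ^ 2 / 20000 with hs
  -- The first entry guarantees `u` and `v` with at most `τ * N` sums in `T`; the second makes all
  -- but `τ * N` elements of `T` unpopular at level `s * N`. The lower bound on `N` absorbs the
  -- rounding in `N / 2`.
  refine ⟨min (κ * τ / 2) (s * τ), by positivity, ⌈1000 / δ⌉₊, ?_⟩
  intro N hN α hα hα2 A₁ A₂ T hA₁ hA₂ hT h1 h2 h3 b b' hbb hU hV
  by_contra! hlt
  set σ := ((∑ n ∈ T, rep A₁ A₂ n : ℕ) : ℝ) with hσ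
  have hN1 : 1000 ≤ δ * N := by
    have := (Nat.le_ceil _).trans (Nat.cast_le (α := ℝ).2 hN)
    rw [div_le_iff₀ hδ] at this
    linarith
  have hN0 : (0 : ℝ) < N := by
    by_contra! h; nlinarith
  set L := N / 2 with hL
  have hL1 : (N : ℝ) ≤ 2 * L + 1 := by
    have : N ≤ 2 * L + 1 := by omega
    exact_mod_cast this
  have hL2 : (2 : ℝ) * L ≤ N := by
    have : 2 * L ≤ N := by omega
    exact_mod_cast this
  have hσ1 : σ < κ * N * (τ * N) := by
    have := mul_le_mul_of_nonneg_right (min_le_left (κ * τ / 2) (s * τ)) (sq_nonneg (N : ℝ))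
    have : 0 < κ * τ * (N : ℝ) ^ 2 := by positivity
    linarith
  have hσ2 : σ ≤ τ * N * (s * N) := by
    have := mul_le_mul_of_nonneg_right (min_le_right (κ * τ / 2) (s * τ)) (sq_nonneg (N : ℝ))
    linarith
  have hτ0 : 0 ≤ τ * N := by positivity
  obtain ⟨u, hu, hTu⟩ := exists_card_filter_add_mem_le (filter_subset _ A₁)
    (hσ1.trans_le (mul_le_mul_of_nonneg_right hU hτ0)) le_rfl
  obtain ⟨v, hv, hTv⟩ := exists_card_filter_add_mem_le (filter_subset _ A₁)
    (hσ1.trans_le (mul_le_mul_of_nonneg_right hV hτ0)) le_rfl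
  obtain ⟨hu, hu1, hu2⟩ := mem_filter.1 hu
  obtain ⟨hv, hv1, hv2⟩ := mem_filter.1 hv
  have huI := mem_Icc.1 (hA₁ hu)
  have hvI := mem_Icc.1 (hA₁ hv)
  have hδL : δ * L ≤ δ * N / 2 := by linarith [mul_le_mul_of_nonneg_left hL2 hδ.le]
  have hδN : δ * N < N := by nlinarith
  have huv : u < v := by
    have : (u : ℝ) < v := by linarith
    exact_mod_cast this
  obtain ⟨ℓ, hℓ⟩ := Int.eq_ofNat_of_zero_le (sub_pos.2 huv).le
  have hv' : v = u + ℓ := by omega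
  have hℓ0 : ℓ ≠ 0 := by omega
  have : NeZero ℓ := ⟨hℓ0⟩
  have hℓR : (ℓ : ℝ) = v - u := by rw [hv']; push_cast; ring
  have hℓL : ℓ ≤ L := by omega
  have hℓL' : (ℓ : ℝ) ≤ L := by exact_mod_cast hℓL
  -- Each endpoint loses at most `δN/100` from the regularity range and `δN/1000` from smoothing.
  have hγ : (L : ℝ) - ℓ ≤ 0.022 * (δ * N) := by rw [hℓR]; linarith
  subst hv'
  have hp : ∀ p : ℕ, p.Prime → p ∣ ℓ → (δ / 50)⁻¹ < p := by
    intro p hp hpl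
    refine inv_lt_prime_of_dvd (ℓ := ℓ) hbb ?_ hp (Int.natCast_dvd_natCast.2 hpl)
    have := hv2.sub hu2
    simpa using this
  have hD := card_addSubgroup_le_of_prime_lt (by positivity : 0 < δ / 50) hp
  have hDle : (⌊δ / 50 * ℓ⌋₊ : ℝ) ≤ 0.01 * (δ * N) :=
    (Nat.floor_le (by positivity)).trans
      (by linarith [mul_le_mul_of_nonneg_left hℓL' hδ.le])
  set D := ⌊δ / 50 * ℓ⌋₊
  have hmain := card_unpopular_add_card_add_card_popular_le (A₁ := A₁) (A₂ := A₂) (s := s * N)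
    (ℓ := ℓ) (L := L) hT (by omega) huI.1 hvI.2 hTu hTv
  have hS := card_filter_rep_ge_mul_le (A₁ := A₁) (A₂ := A₂) (T := T) (s := s * N) hσ.ge
  have hS' : (#T : ℝ) - τ * N ≤ #{n ∈ T | (rep A₁ A₂ n : ℝ) < s * N} := by
    have := le_of_mul_le_mul_right (hS.trans hσ2) (by positivity)
    linarith
  set A := A₁ ∩ Ico u (u + ℓ) with hA
  set B := A₂ ∩ Icc 1 (ℓ : ℤ) with hB
  have hAc : (#A₁ : ℝ) ≤ #A + (L - ℓ) := by
    have : A₁ ⊆ A ∪ (Icc 1 (u - 1) ∪ Icc (u + ℓ) L) := by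
      intro a ha
      have := mem_Icc.1 (hA₁ ha)
      simp only [hA, mem_union, mem_inter, mem_Icc, mem_Ico, ha, true_and]
      omega
    have := (card_le_card this).trans ((card_union_le _ _).trans
      (Nat.add_le_add_left (card_union_le _ _) _))
    rw [Int.card_Icc, Int.card_Icc] at this
    have : #A₁ + ℓ ≤ #A + L := by omega
    have : (#A₁ : ℝ) + ℓ ≤ #A + L := by exact_mod_cast this
    linarith
  have hBc : (#A₂ : ℝ) ≤ #B + (L - ℓ) := by
    have : A₂ ⊆ B ∪ Icc (ℓ + 1) (L : ℤ) := by
      intro a ha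
      have := mem_Icc.1 (hA₂ ha)
      simp only [hB, mem_union, mem_inter, mem_Icc, ha, true_and]
      omega
    have := (card_le_card this).trans (card_union_le _ _)
    rw [Int.card_Icc] at this
    have : #A₂ + ℓ ≤ #B + L := by omega
    have : (#A₂ : ℝ) + ℓ ≤ #B + L := by exact_mod_cast this
    linarith
  -- Large enough that the popularity threshold costs little after division by `t`, small enough
  -- that losing `t` from `#A + #B` is harmless.
  set t := ⌊0.01 * (δ * N)⌋₊ with ht
  have ht1 : (t : ℝ) ≤ 0.01 * (δ * N) := Nat.floor_le (by positivity)
  have ht2 : 0.005 * (δ * N) ≤ t := by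
    have := Nat.lt_floor_add_one (0.01 * (δ * N))
    rw [← ht] at this
    linarith
  have hαL : ∀ i, δ * L ≤ α i * L := fun i => mul_le_mul_of_nonneg_right (hα.1 i) (by positivity)
  have hδL' : δ * N ≤ 2 * (δ * L) + 1 := by
    linarith [mul_le_mul_of_nonneg_left hL1 hδ.le]
  have htA : t ≤ #A := by
    have : (t : ℝ) ≤ #A := by linarith [hαL 0]
    exact_mod_cast this
  have htB : t ≤ #B := by
    have : (t : ℝ) ≤ #B := by linarith [hαL 1]
    exact_mod_cast this
  have hcA : #(A.image (Int.cast : ℤ → ZMod ℓ)) = #A := card_image_intCast inter_subset_right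
  have hcB : #(B.image (Int.cast : ℤ → ZMod ℓ)) = #B := by
    refine card_image_intCast (u := 1) fun x hx => ?_
    have := mem_Icc.1 (mem_inter.1 hx).2
    exact mem_Ico.2 (by omega)
  have hpop := mul_min_le_card_popular hD (A.image (Int.cast : ℤ → ZMod ℓ))
    (B.image (Int.cast : ℤ → ZMod ℓ)) t (hcA ▸ htA) (hcB ▸ htB)
    (s := 2 * (s * N)) (by positivity)
  rw [hcA, hcB, ZMod.card] at hpop
  have hpop' : min (ℓ : ℝ) (#A + #B - t - D) ≤
      #{x : ZMod ℓ | 2 * (s * N) ≤ rep (A.image (Int.cast : ℤ → ZMod ℓ)) (B.image Int.cast) x}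
        + 0.01 * (δ * N) := by
    have ht0 : (0 : ℝ) < t := by linarith
    refine le_of_mul_le_mul_left (hpop.trans ?_) ht0
    rw [mul_add]
    refine add_le_add le_rfl ?_
    have e1 : 2 * (s * N) * ℓ ≤ 2 * (s * N) * (N / 2) :=
      mul_le_mul_of_nonneg_left (by linarith) (by positivity)
    have e2 : 0.005 * (δ * N) * (0.01 * (δ * N)) ≤ t * (0.01 * (δ * N)) :=
      mul_le_mul_of_nonneg_right ht2 (by positivity)
    -- This identity dictates the value `δ ^ 2 / 20000` of `s`.
    have e3 : 2 * (s * N) * (N / 2) = 0.005 * (δ * N) * (0.01 * (δ * N)) := by rw [hs]; ring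
    linarith
  have hmin : (1 + δ) * N - 4 - 0.005 * (δ * N) - 3 * (0.022 * (δ * N)) - 0.02 * (δ * N) ≤
      #T + #B + min (ℓ : ℝ) (#A + #B - t - D) := by
    have hc := mul_le_mul_of_nonneg_right hα.2 hN0.le
    have hα1 : ∀ i, 0 ≤ α i := fun i => hδ.le.trans (hα.1 i)
    have hz : 0 ≤ (N : ℝ) - 2 * L := by linarith
    have hz1 : (N : ℝ) - 2 * L ≤ 1 := by linarith
    -- The two alternatives are matched with the two upper bounds for `min 1 (α 0 + α 1)` in the
    -- mean condition.
    rcases min_cases (ℓ : ℝ) (#A + #B - t - D) with ⟨e, _⟩ | ⟨e, _⟩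
    · rw [e]
      have hm := min_le_left (1 : ℝ) (α 0 + α 1)
      have hm' := mul_le_mul_of_nonneg_right hm hN0.le
      have : α 1 * (N - 2 * L) ≤ 2 * 1 := mul_le_mul (hα2 1) hz1 hz (by norm_num)
      linarith
    · rw [e]
      have hm := min_le_right (1 : ℝ) (α 0 + α 1)
      have hm' := mul_le_mul_of_nonneg_right hm hN0.le
      have : α 1 * (N - 2 * L) ≤ 2 * 1 := mul_le_mul (hα2 1) hz1 hz (by norm_num)
      have : α 0 * (N - 2 * L) ≤ 2 * 1 := mul_le_mul (hα2 0) hz1 hz (by norm_num)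
      linarith
  have hmain' : (#{n ∈ T | (rep A₁ A₂ n : ℝ) < s * N} : ℝ) + #B +
      #{x : ZMod ℓ | 2 * (s * N) ≤ rep (A.image (Int.cast : ℤ → ZMod ℓ)) (B.image Int.cast) x}
      ≤ N + 1 + 2 * (τ * N) := by
    refine le_trans (le_of_eq ?_) (hmain.trans (le_of_eq (by push_cast; ring)))
    congr!
  have hτN : τ * N = 0.01 * (δ * N) := by rw [hτ]; ring
  rw [hτN] at hmain' hS'
  linarith

/-! ### Characters and exponential sums -/

/-- The additive character `e(x) = exp(2πix)`. -/
noncomputable def e (x : ℝ) : ℂ := Complex.exp (2 * Real.pi * Complex.I * x)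

lemma e_add (x y : ℝ) : e (x + y) = e x * e y := by
  rw [e, e, e, ← Complex.exp_add]; push_cast; ring_nf

lemma e_zero : e 0 = 1 := by simp [e]

lemma norm_e (x : ℝ) : ‖e x‖ = 1 := by
  have : e x = Complex.exp ((2 * Real.pi * x : ℝ) * Complex.I) := by
    rw [e]; push_cast; ring_nf
  rw [this, Complex.norm_exp_ofReal_mul_I]

lemma e_intCast (k : ℤ) : e k = 1 := by
  rw [e, Complex.exp_eq_one_iff]
  exact ⟨k, by push_cast; ring⟩

lemma e_neg (x : ℝ) : e (-x) = starRingEnd ℂ (e x) := by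
  rw [e, e, ← Complex.exp_conj]
  simp [Complex.conj_ofReal, Complex.conj_ofNat]

lemma continuous_e : Continuous e := by unfold e; fun_prop

lemma norm_e_sub_one_le (x : ℝ) : ‖e x - 1‖ ≤ 2 * Real.pi * |x| := by
  have h : e x = Complex.exp (Complex.I * (2 * Real.pi * x : ℝ)) := by
    rw [e]; push_cast; ring_nf
  rw [h]
  refine (Real.norm_exp_I_mul_ofReal_sub_one_le).trans ?_
  rw [Real.norm_eq_abs, abs_mul, abs_of_pos Real.two_pi_pos]

lemma norm_e_sub_e_le (x y : ℝ) : ‖e x - e y‖ ≤ 2 * Real.pi * |x - y| := by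
  have : e x - e y = e y * (e (x - y) - 1) := by
    rw [mul_sub, ← e_add]; ring_nf
  rw [this, norm_mul, norm_e, one_mul]
  exact norm_e_sub_one_le _

lemma norm_e_sub_one_le_of_int (x : ℝ) (z : ℤ) : ‖e x - 1‖ ≤ 2 * Real.pi * |x - z| := by
  rw [← e_intCast z]; exact norm_e_sub_e_le _ _

lemma e_eq_one_iff {x : ℝ} : e x = 1 ↔ ∃ k : ℤ, x = k := by
  refine ⟨fun h => ?_, by rintro ⟨k, rfl⟩; exact e_intCast k⟩
  rw [e, Complex.exp_eq_one_iff] at h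
  obtain ⟨k, hk⟩ := h
  refine ⟨k, ?_⟩
  have h2 : (2 * Real.pi * Complex.I) * (x : ℂ) = (2 * Real.pi * Complex.I) * (k : ℂ) := by
    rw [hk]; ring
  have h3 := mul_left_cancel₀ Complex.two_pi_I_ne_zero h2
  exact_mod_cast h3

lemma e_natCast_mul (r : ℕ) (x : ℝ) : e (r * x) = e x ^ r := by
  rw [e, e, ← Complex.exp_nat_mul]; push_cast; ring_nf

/-- Orthogonality of characters of `ℤ/Nℤ`. -/
lemma sum_e_mul_div {N : ℕ} (hN : N ≠ 0) (k : ℤ) :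
    ∑ r ∈ range N, e (k * ((r : ℝ) / N)) = if (N : ℤ) ∣ k then (N : ℂ) else 0 := by
  have hN' : (N : ℝ) ≠ 0 := by exact_mod_cast hN
  have h1 : ∀ r : ℕ, e (k * ((r : ℝ) / N)) = e (k / N) ^ r := fun r => by
    rw [← e_natCast_mul]; ring_nf
  simp_rw [h1]
  split_ifs with h
  · obtain ⟨m, rfl⟩ := h
    have : e (((N * m : ℤ) : ℝ) / N) = 1 := by
      rw [e_eq_one_iff]; exact ⟨m, by push_cast; field_simp⟩
    simp_rw [this]
    simp
  · have hne : e ((k : ℝ) / N) ≠ 1 := by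
      rw [Ne, e_eq_one_iff]
      rintro ⟨m, hm⟩
      rw [div_eq_iff hN'] at hm
      exact h ⟨m, by rw [mul_comm]; exact_mod_cast hm⟩
    rw [geom_sum_eq hne, ← e_natCast_mul, mul_div_cancel₀ _ hN', e_intCast]
    simp

/-- Orthogonality of characters of `ℝ/ℤ`. -/
lemma integral_e_mul (k : ℤ) :
    ∫ θ in (0 : ℝ)..1, e (k * θ) = if k = 0 then 1 else 0 := by
  split_ifs with h
  · simp [h, e_zero]
  · have hc : (2 * Real.pi * Complex.I * k : ℂ) ≠ 0 :=
      mul_ne_zero Complex.two_pi_I_ne_zero (by exact_mod_cast h)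
    have h1 : ∀ θ : ℝ, e (k * θ) = Complex.exp ((2 * Real.pi * Complex.I * k) * θ) := fun θ => by
      rw [e]; push_cast; ring_nf
    simp_rw [h1]
    rw [integral_exp_mul_complex hc]
    have h2 := e_intCast k
    rw [e] at h2
    have h3 : (2 * Real.pi * Complex.I * k * (1 : ℝ) : ℂ) = 2 * Real.pi * Complex.I * (k : ℝ) := by
      push_cast; ring
    rw [h3, h2]; simp

/-- The extension by zero to `ℤ` of a function on `[1, N]`. -/
noncomputable def ext (N : ℕ) (f : ℕ → ℝ) (n : ℤ) : ℝ := if n ∈ Icc (1 : ℤ) N then f n.toNat else 0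

/-- The exponential sum of `f` over the finite set `S`. -/
noncomputable def expSum (S : Finset ℤ) (f : ℤ → ℝ) (θ : ℝ) : ℂ := ∑ n ∈ S, (f n : ℂ) * e (n * θ)

lemma sum_Icc_intCast {M : Type*} [AddCommMonoid M] (N : ℕ) (F : ℤ → M) :
    ∑ n ∈ Icc (1 : ℤ) N, F n = ∑ n ∈ Icc 1 N, F (n : ℕ) := by
  symm
  refine sum_bij' (fun n _ => (n : ℤ)) (fun n _ => n.toNat) ?_ ?_ ?_ ?_ ?_ <;>
    simp only [mem_Icc] <;> intros <;> first | omega | trivial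

lemma ext_natCast {N n : ℕ} (h : n ∈ Icc 1 N) (f : ℕ → ℝ) : ext N f n = f n := by
  rw [mem_Icc] at h
  rw [ext, if_pos (mem_Icc.2 (by omega)), Int.toNat_natCast]

lemma ext_of_notMem {N : ℕ} {n : ℤ} (h : n ∉ Icc (1 : ℤ) N) (f : ℕ → ℝ) : ext N f n = 0 := if_neg h

lemma ext_nonneg {N : ℕ} {f : ℕ → ℝ} (h : ∀ n ∈ Icc 1 N, 0 ≤ f n) (n : ℤ) : 0 ≤ ext N f n := by
  rw [ext]
  split_ifs with hn
  · rw [mem_Icc] at hn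
    exact h _ (mem_Icc.2 (by omega))
  · exact le_rfl

lemma expSum_ext (N : ℕ) (f : ℕ → ℝ) (θ : ℝ) :
    expSum (Icc (1 : ℤ) N) (ext N f) θ = fourierSum N f θ := by
  rw [expSum, sum_Icc_intCast, fourierSum]
  refine sum_congr rfl fun n hn => ?_
  rw [ext_natCast hn, e]
  push_cast; rfl

lemma continuous_expSum (S : Finset ℤ) (f : ℤ → ℝ) : Continuous (expSum S f) := by
  unfold expSum
  exact continuous_finsetSum _ fun n _ => continuous_const.mul
    (continuous_e.comp (continuous_const.mul continuous_id))

lemma norm_expSum_le (S : Finset ℤ) {f : ℤ → ℝ} (hf : ∀ n, 0 ≤ f n) (θ : ℝ) :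
    ‖expSum S f θ‖ ≤ ∑ n ∈ S, f n := by
  refine norm_sum_le_of_le _ fun n _ => ?_
  rw [norm_mul, norm_e, mul_one, Complex.norm_real, Real.norm_of_nonneg (hf n)]

lemma norm_expSum_sub_le {N : ℕ} {f : ℤ → ℝ} (hf : ∀ n, 0 ≤ f n) (θ θ' : ℝ) :
    ‖expSum (Icc (1 : ℤ) N) f θ - expSum (Icc (1 : ℤ) N) f θ'‖ ≤
      2 * Real.pi * N * (∑ n ∈ Icc (1 : ℤ) N, f n) * |θ - θ'| := by
  rw [expSum, expSum, ← sum_sub_distrib, mul_sum, sum_mul]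
  refine norm_sum_le_of_le _ fun n hn => ?_
  rw [mem_Icc] at hn
  have h1 : |(n : ℝ)| ≤ N := by
    rw [abs_of_nonneg (by exact_mod_cast (by omega : (0 : ℤ) ≤ n))]; exact_mod_cast hn.2
  rw [← mul_sub, norm_mul, Complex.norm_real, Real.norm_of_nonneg (hf n)]
  have h2 := norm_e_sub_e_le (n * θ) (n * θ')
  rw [← mul_sub, abs_mul] at h2
  have h3 : 2 * Real.pi * (|(n : ℝ)| * |θ - θ'|) ≤ 2 * Real.pi * (N * |θ - θ'|) := by gcongr
  calc f n * ‖e (n * θ) - e (n * θ')‖ ≤ f n * (2 * Real.pi * (N * |θ - θ'|)) :=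
        mul_le_mul_of_nonneg_left (h2.trans h3) (hf n)
    _ = _ := by ring

/-! ### Smoothing and its Fourier multiplier -/

/-- The average of `f (n + b - b')` over `b, b' ∈ B`. -/
noncomputable def smooth (B : Finset ℤ) (f : ℤ → ℝ) (n : ℤ) : ℝ :=
  (∑ b ∈ B, ∑ b' ∈ B, f (n + b - b')) / (#B : ℝ) ^ 2

/-- The multiplier on the Fourier side of the operator `smooth B`. -/
noncomputable def multiplier (B : Finset ℤ) (θ : ℝ) : ℝ :=
  ‖∑ b ∈ B, e (b * θ)‖ ^ 2 / (#B : ℝ) ^ 2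

lemma smooth_nonneg (B : Finset ℤ) {f : ℤ → ℝ} (hf : ∀ n, 0 ≤ f n) (n : ℤ) : 0 ≤ smooth B f n :=
  div_nonneg (sum_nonneg fun _ _ => sum_nonneg fun _ _ => hf _) (by positivity)

/-- The window is widened by `w` on both sides so that a shift by at most `w` loses no part of the
support. -/
lemma sum_shift {M : Type*} [AddCommMonoid M] {N w : ℕ} {F : ℤ → M}
    (hF : ∀ n ∉ Icc (1 : ℤ) N, F n = 0) {d : ℤ} (hd : |d| ≤ w) :
    ∑ n ∈ Icc (1 - (w : ℤ)) (N + w), F (n + d) = ∑ n ∈ Icc (1 : ℤ) N, F n := by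
  rw [abs_le] at hd
  have h1 : ∑ n ∈ Icc (1 - (w : ℤ)) (N + w), F (n + d)
      = ∑ n ∈ Icc (1 - (w : ℤ) + d) (N + w + d), F n := by
    rw [← map_add_right_Icc, sum_map]; rfl
  rw [h1]
  symm
  exact sum_subset (Icc_subset_Icc (by omega) (by omega)) fun n _ hn => hF n hn

lemma sum_sum_e_sub (B : Finset ℤ) (θ : ℝ) :
    ∑ b ∈ B, ∑ b' ∈ B, e ((b' - b : ℤ) * θ) = ((‖∑ b ∈ B, e (b * θ)‖ ^ 2 : ℝ) : ℂ) := by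
  rw [Complex.ofReal_pow, ← Complex.conj_mul', map_sum, sum_mul_sum]
  refine sum_congr rfl fun b _ => sum_congr rfl fun b' _ => ?_
  rw [← e_neg, ← e_add]; push_cast; ring_nf

lemma expSum_smooth {N w : ℕ} {B : Finset ℤ} (hB : B ⊆ Icc 0 (w : ℤ)) {f : ℤ → ℝ}
    (hf : ∀ n ∉ Icc (1 : ℤ) N, f n = 0) (θ : ℝ) :
    expSum (Icc (1 - (w : ℤ)) (N + w)) (smooth B f) θ =
      multiplier B θ * expSum (Icc (1 : ℤ) N) f θ := by
  have h1 : ∀ b ∈ B, ∀ b' ∈ B, ∑ n ∈ Icc (1 - (w : ℤ)) (N + w), (f (n + b - b') : ℂ) * e (n * θ) =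
      e ((b' - b : ℤ) * θ) * expSum (Icc (1 : ℤ) N) f θ := by
    intro b hb b' hb'
    have h2 := mem_Icc.1 (hB hb)
    have h3 := mem_Icc.1 (hB hb')
    rw [expSum, mul_sum, ← sum_shift (w := w) (d := b - b') _ (abs_le.2 (by omega))]
    · refine sum_congr rfl fun n _ => ?_
      rw [mul_left_comm, ← e_add, add_sub_assoc]
      push_cast; ring_nf
    · intro n hn; simp [hf n hn]
  rw [multiplier, Complex.ofReal_div, ← sum_sum_e_sub, div_mul_eq_mul_div, sum_mul]
  simp_rw [sum_mul]
  rw [← sum_congr rfl fun b hb => sum_congr rfl fun b' hb' => h1 b hb b' hb', expSum]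
  have h4 : ∀ n : ℤ, (smooth B f n : ℂ) * e (n * θ) =
      (∑ b ∈ B, ∑ b' ∈ B, (f (n + b - b') : ℂ) * e (n * θ)) / (((#B : ℝ) ^ 2 : ℝ) : ℂ) := by
    intro n
    rw [smooth]
    push_cast
    rw [div_mul_eq_mul_div, sum_mul]
    simp_rw [sum_mul]
  simp_rw [h4]
  rw [← sum_div, sum_comm]
  congr 1
  exact sum_congr rfl fun b _ => sum_comm

lemma multiplier_nonneg (B : Finset ℤ) (θ : ℝ) : 0 ≤ multiplier B θ := by
  unfold multiplier; positivity

lemma multiplier_le_one (B : Finset ℤ) (θ : ℝ) : multiplier B θ ≤ 1 := by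
  refine div_le_one_of_le₀ (pow_le_pow_left₀ (norm_nonneg _) ?_ 2) (by positivity)
  refine (norm_sum_le_of_le B (f := fun b : ℤ => e (b * θ)) (n := fun _ => 1)
    fun b _ => (norm_e _).le).trans ?_
  simp

lemma continuous_multiplier (B : Finset ℤ) : Continuous (multiplier B) := by
  unfold multiplier
  refine ((Continuous.norm ?_).pow 2).div_const _
  exact continuous_finsetSum _ fun n _ => continuous_e.comp (continuous_const.mul continuous_id)

/-- Expanding the square shows that the multiplier is the average of `e ((b' - b) θ)` over pairs
from `B`. -/
lemma one_sub_multiplier_le {B : Finset ℤ} (hB : B.Nonempty) {θ ρ : ℝ}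
    (h : ∀ b ∈ B, ∀ b' ∈ B, ‖e ((b' - b : ℤ) * θ) - 1‖ ≤ ρ) : 1 - multiplier B θ ≤ ρ := by
  have hc : (0 : ℝ) < #B := by exact_mod_cast hB.card_pos
  have h1 : ((1 - multiplier B θ : ℝ) : ℂ) =
      -(∑ b ∈ B, ∑ b' ∈ B, (e ((b' - b : ℤ) * θ) - 1)) / (((#B : ℝ) ^ 2 : ℝ) : ℂ) := by
    simp_rw [sum_sub_distrib]
    rw [sum_sum_e_sub, multiplier]
    have : ((#B : ℝ) : ℂ) ≠ 0 := by exact_mod_cast hc.ne'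
    push_cast at this ⊢
    rw [eq_div_iff (pow_ne_zero 2 this), sub_mul, div_mul_cancel₀ _ (pow_ne_zero 2 this)]
    simp only [sum_const, nsmul_eq_mul]
    ring
  have h2 : ‖∑ b ∈ B, ∑ b' ∈ B, (e ((b' - b : ℤ) * θ) - 1)‖ ≤ #B * (#B * ρ) := by
    rw [← nsmul_eq_mul, ← nsmul_eq_mul, ← sum_const, ← sum_const]
    exact norm_sum_le_of_le _ fun b hb => norm_sum_le_of_le _ fun b' hb' => h b hb b' hb'
  have h3 : |1 - multiplier B θ| ≤ ρ := by
    rw [← Real.norm_eq_abs, ← Complex.norm_real, h1, norm_div, norm_neg, Complex.norm_real,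
      Real.norm_of_nonneg (by positivity), div_le_iff₀ (by positivity)]
    linarith
  exact (le_abs_self _).trans h3

/-- Parseval's identity modulo `N`. -/
lemma sum_norm_sq_sum_e {N : ℕ} (hN : N ≠ 0) {B : Finset ℤ} (hB : B ⊆ Ico 0 (N : ℤ)) :
    ∑ r ∈ range N, ‖∑ b ∈ B, e (b * ((r : ℝ) / N))‖ ^ 2 = N * #B := by
  have h1 : ∀ b ∈ B, ∑ b' ∈ B, ∑ r ∈ range N, e ((b' - b : ℤ) * ((r : ℝ) / N)) = N := by
    intro b hb
    simp_rw [sum_e_mul_div hN]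
    rw [sum_eq_single_of_mem b hb, if_pos (by simp)]
    intro b' hb' hne
    have h2 := mem_Ico.1 (hB hb)
    have h3 := mem_Ico.1 (hB hb')
    rw [if_neg]
    intro hd
    exact hne (by have := Int.eq_zero_of_abs_lt_dvd hd (abs_lt.2 (by omega)); omega)
  have h2 : ((∑ r ∈ range N, ‖∑ b ∈ B, e (b * ((r : ℝ) / N))‖ ^ 2 : ℝ) : ℂ) = N * #B := by
    rw [Complex.ofReal_sum]
    simp_rw [← sum_sum_e_sub]
    rw [sum_comm]
    calc _ = ∑ b ∈ B, ∑ b' ∈ B, ∑ r ∈ range N, e ((b' - b : ℤ) * ((r : ℝ) / N)) :=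
          sum_congr rfl fun b _ => sum_comm
      _ = ∑ b ∈ B, (N : ℂ) := sum_congr rfl h1
      _ = _ := by rw [sum_const, nsmul_eq_mul, mul_comm]
  exact_mod_cast h2

/-- A smoothed minorant of a pseudorandom majorant is almost bounded by `1`. -/
lemma smooth_ext_le {N : ℕ} (hN : N ≠ 0) {B : Finset ℤ} (hB : B ⊆ Ico 0 (N : ℤ)) (hB0 : B.Nonempty)
    {η : ℝ} (hη : 0 ≤ η) {ν a : ℕ → ℝ} (ha : ∀ n ∈ Icc 1 N, 0 ≤ a n ∧ a n ≤ ν n)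
    (hν : IsPseudorandom η N ν) (n : ℤ) :
    smooth B (ext N a) n ≤ 1 + η + η * (N / #B) := by
  have hN' : (0 : ℝ) < N := by exact_mod_cast Nat.pos_of_ne_zero hN
  have hc : (0 : ℝ) < #B := by exact_mod_cast hB0.card_pos
  have hν0 : ∀ n ∈ Icc 1 N, 0 ≤ ν n := fun n hn => (ha n hn).1.trans (ha n hn).2
  -- The equality `m = n + b - b'` is relaxed to a congruence modulo `N`. Only the frequencies `r /
  -- N` then occur, and these are the ones at which pseudorandomness is assumed.
  set X : ℝ := ∑ b ∈ B, ∑ b' ∈ B, ∑ m ∈ Icc (1 : ℤ) N,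
    ext N ν m * (if (N : ℤ) ∣ m - (n + b - b') then 1 else 0) with hX
  have h1 : ∑ b ∈ B, ∑ b' ∈ B, ext N a (n + b - b') ≤ X := by
    refine sum_le_sum fun b _ => sum_le_sum fun b' _ => ?_
    have hnn : ∀ m ∈ Icc (1 : ℤ) N,
        0 ≤ ext N ν m * (if (N : ℤ) ∣ m - (n + b - b') then (1 : ℝ) else 0) := fun m _ =>
      mul_nonneg (ext_nonneg hν0 m) (by split_ifs <;> norm_num)
    by_cases hm : n + b - b' ∈ Icc (1 : ℤ) N
    · refine le_trans ?_ (single_le_sum hnn hm)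
      rw [sub_self, if_pos (dvd_zero _), mul_one, ext, ext, if_pos hm, if_pos hm]
      refine (ha _ ?_).2
      rw [mem_Icc] at hm ⊢
      omega
    · rw [ext_of_notMem hm]
      exact sum_nonneg hnn
  set F : ℕ → ℂ := fun r => ∑ b ∈ B, e (b * ((r : ℝ) / N)) with hF
  have h2 : (N : ℂ) * (X : ℂ) = ∑ r ∈ range N,
      fourierSum N ν ((r : ℝ) / N) * e (-(n * ((r : ℝ) / N))) * ((‖F r‖ ^ 2 : ℝ) : ℂ) := by
    simp_rw [hF, ← sum_sum_e_sub, ← expSum_ext, expSum, mul_sum, sum_mul]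
    rw [hX]
    simp_rw [Complex.ofReal_sum, Complex.ofReal_mul]
    rw [mul_sum, sum_comm]
    refine sum_congr rfl fun b _ => ?_
    rw [mul_sum, sum_comm]
    refine sum_congr rfl fun b' _ => ?_
    rw [mul_sum, sum_comm]
    refine sum_congr rfl fun m _ => ?_
    rw [mul_left_comm]
    have : (N : ℂ) * ((if (N : ℤ) ∣ m - (n + b - b') then 1 else 0 : ℝ) : ℂ) =
        ∑ r ∈ range N, e ((m - (n + b - b') : ℤ) * ((r : ℝ) / N)) := by
      rw [sum_e_mul_div hN]; split_ifs <;> simp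
    rw [this, mul_sum]
    refine sum_congr rfl fun r _ => ?_
    rw [mul_assoc, mul_assoc, ← e_add, ← e_add]
    push_cast; ring_nf
  -- Frequency zero gives the main term; the others carry a factor `η * N` and are summed by
  -- Parseval.
  have h3 : ∀ r ∈ range N, ‖fourierSum N ν ((r : ℝ) / N) * e (-(n * ((r : ℝ) / N))) *
      ((‖F r‖ ^ 2 : ℝ) : ℂ)‖ ≤ η * N * ‖F r‖ ^ 2 + (if r = 0 then N * (#B : ℝ) ^ 2 else 0) := by
    intro r hr
    rw [norm_mul, norm_mul, norm_e, mul_one, Complex.norm_real,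
      Real.norm_of_nonneg (by positivity)]
    have := hν r (mem_range.1 hr)
    split_ifs at this ⊢ with h0
    · have h4 : ‖fourierSum N ν ((r : ℝ) / N)‖ ≤ η * N + N := by
        have := (norm_sub_norm_le _ _).trans this
        rw [Complex.norm_natCast] at this
        linarith
      have h5 : ‖F r‖ = #B := by simp [hF, h0, e_zero]
      calc _ ≤ (η * N + N) * ‖F r‖ ^ 2 := mul_le_mul_of_nonneg_right h4 (by positivity)
        _ = _ := by rw [add_mul, h5]
    · rw [sub_zero] at this
      rw [add_zero]
      exact mul_le_mul_of_nonneg_right this (by positivity)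
  have h4 : N * X ≤ η * N * (N * #B) + N * (#B : ℝ) ^ 2 := by
    have h5 := norm_sum_le_of_le _ h3
    rw [← h2, sum_add_distrib, ← mul_sum, sum_norm_sq_sum_e hN hB, sum_ite_eq',
      if_pos (mem_range.2 (Nat.pos_of_ne_zero hN)), norm_mul, Complex.norm_natCast,
      Complex.norm_real] at h5
    exact (mul_le_mul_of_nonneg_left (le_abs_self X) hN'.le).trans h5
  have h5 : X ≤ η * (N * #B) + (#B : ℝ) ^ 2 := by
    refine le_of_mul_le_mul_left (h4.trans (le_of_eq ?_)) hN'
    ring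
  rw [smooth, div_le_iff₀ (by positivity)]
  refine h1.trans (h5.trans ?_)
  have : (1 + η + η * (N / #B)) * (#B : ℝ) ^ 2 = (#B : ℝ) ^ 2 + η * (#B : ℝ) ^ 2 + η * (N * #B) := by
    field_simp
  rw [this]
  linarith [mul_nonneg hη (sq_nonneg (#B : ℝ))]

/-! ### Third moments, large frequencies and transference -/

/-- A function satisfying an `L^q` bound and a supremum bound has a small third moment. -/
lemma integral_pow_three_le {q K ω : ℝ} (hq : 2 < q) (hq3 : q < 3) (hω : 0 < ω) {N : ℕ}
    (hN : N ≠ 0) {a : ℕ → ℝ} (ha : LqExtension q K N a) {F : ℝ → ℝ} (hF : Continuous F)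
    (hF0 : ∀ θ, 0 ≤ F θ) (hFa : ∀ θ, F θ ≤ ‖fourierSum N a θ‖)
    (hFω : ∀ θ ∈ Set.Icc (0 : ℝ) 1, F θ ≤ ω * N) :
    ∫ θ in (0 : ℝ)..1, F θ ^ 3 ≤ ω ^ (3 - q) * |K| ^ q * (N : ℝ) ^ 2 := by
  have hN' : (0 : ℝ) < N := by exact_mod_cast Nat.pos_of_ne_zero hN
  have hcont : Continuous fun θ => ‖fourierSum N a θ‖ := by
    simp_rw [← expSum_ext]; exact (continuous_expSum _ _).norm
  have hcq : Continuous fun θ => ‖fourierSum N a θ‖ ^ q :=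
    hcont.rpow_const fun _ => Or.inr (by linarith)
  have hI0 : 0 ≤ ∫ θ in (0 : ℝ)..1, ‖fourierSum N a θ‖ ^ q :=
    intervalIntegral.integral_nonneg zero_le_one fun θ _ => by positivity
  have hI : ∫ θ in (0 : ℝ)..1, ‖fourierSum N a θ‖ ^ q ≤ |K| ^ q * (N : ℝ) ^ (q - 1) := by
    have h1 : (∫ θ in (0 : ℝ)..1, ‖fourierSum N a θ‖ ^ q) ^ (1 / q) ≤
        |K| * (N : ℝ) ^ (1 - 1 / q) :=
      le_trans ha (mul_le_mul_of_nonneg_right (le_abs_self K) (by positivity))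
    have h2 := Real.rpow_le_rpow (Real.rpow_nonneg hI0 _) h1 (by linarith : 0 ≤ q)
    rw [← Real.rpow_mul hI0, one_div_mul_cancel (by linarith), Real.rpow_one,
      Real.mul_rpow (abs_nonneg _) (by positivity), ← Real.rpow_mul hN'.le] at h2
    have h3 : (1 - 1 / q) * q = q - 1 := by field_simp
    rwa [h3] at h2
  have hpt : ∀ θ ∈ Set.Icc (0 : ℝ) 1, F θ ^ 3 ≤ (ω * N) ^ (3 - q) * ‖fourierSum N a θ‖ ^ q := by
    intro θ hθ
    have h1 : F θ ^ 3 = F θ ^ (3 - q) * F θ ^ q := by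
      rw [← Real.rpow_natCast, ← Real.rpow_add_of_nonneg (hF0 θ) (by linarith) (by linarith)]
      norm_num
    rw [h1]
    exact mul_le_mul (Real.rpow_le_rpow (hF0 θ) (hFω θ hθ) (by linarith))
      (Real.rpow_le_rpow (hF0 θ) (hFa θ) (by linarith)) (Real.rpow_nonneg (hF0 θ) _)
      (by positivity)
  calc ∫ θ in (0 : ℝ)..1, F θ ^ 3
      ≤ ∫ θ in (0 : ℝ)..1, (ω * N) ^ (3 - q) * ‖fourierSum N a θ‖ ^ q :=
        intervalIntegral.integral_mono_on zero_le_one ((hF.pow 3).intervalIntegrable _ _)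
          ((continuous_const.mul hcq).intervalIntegrable _ _) hpt
    _ = (ω * N) ^ (3 - q) * ∫ θ in (0 : ℝ)..1, ‖fourierSum N a θ‖ ^ q := by
        rw [intervalIntegral.integral_const_mul]
    _ ≤ (ω * N) ^ (3 - q) * (|K| ^ q * (N : ℝ) ^ (q - 1)) :=
        mul_le_mul_of_nonneg_left hI (by positivity)
    _ = _ := by
        have : (N : ℝ) ^ 2 = (N : ℝ) ^ (3 - q) * (N : ℝ) ^ (q - 1) := by
          rw [← Real.rpow_add hN', ← Real.rpow_natCast]; norm_num
        rw [this, Real.mul_rpow hω.le hN'.le]; ring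

open Classical in
/-- The large values of a slowly varying function with bounded third moment lie in few of the
intervals `[j / N, (j + 1) / N]`. -/
lemma card_large_intervals_le {N : ℕ} (hN : N ≠ 0) {F : ℝ → ℝ} (hF : Continuous F)
    (hF0 : ∀ θ, 0 ≤ F θ) {C C' ω : ℝ} (hω : 0 < ω) (hω1 : ω ≤ C')
    (hL : ∀ θ θ', F θ - F θ' ≤ C' * (N : ℝ) ^ 2 * |θ - θ'|)
    (hI : ∫ θ in (0 : ℝ)..1, F θ ^ 3 ≤ C * (N : ℝ) ^ 2) :
    (#{j ∈ range N | ∃ θ ∈ Set.Icc (((j : ℕ) : ℝ) / N) (((j + 1 : ℕ) : ℝ) / N), ω * N ≤ F θ} : ℝ) ≤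
      C / ((ω / 2) ^ 3 * (ω / (2 * C'))) := by
  have hN' : (0 : ℝ) < N := by exact_mod_cast Nat.pos_of_ne_zero hN
  have hC' : 0 < C' := hω.trans_le hω1
  set J := {j ∈ range N | ∃ θ ∈ Set.Icc (((j : ℕ) : ℝ) / N) (((j + 1 : ℕ) : ℝ) / N), ω * N ≤ F θ} with hJ
  have hii : ∀ x y : ℝ, IntervalIntegrable (fun θ => F θ ^ 3) MeasureTheory.volume x y :=
    fun x y => (hF.pow 3).intervalIntegrable _ _
  -- Within distance `s` the function drops by at most `ω * N / 2`. As `2 * s ≤ 1 / N`, an interval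
  -- of length `s` on one side of `θ` stays inside the given interval.
  set s := ω / (2 * C') / N with hs
  have hs0 : 0 < s := by positivity
  have hsN : 2 * s ≤ 1 / N := by
    rw [hs, ← mul_div_assoc]
    gcongr
    rw [← mul_div_assoc, mul_div_mul_left _ _ two_ne_zero, div_le_one hC']
    exact hω1
  have hloc : ∀ x y : ℝ, x ≤ y → y - x = s → (∃ θ, ω * N ≤ F θ ∧ ∀ z ∈ Set.Icc x y, |θ - z| ≤ s) →
      (ω * N / 2) ^ 3 * s ≤ ∫ θ in x..y, F θ ^ 3 := by
    rintro x y hxy hs' ⟨θ, hθ, hz⟩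
    have : ∫ _ in x..y, (ω * N / 2) ^ 3 = (ω * N / 2) ^ 3 * s := by
      rw [intervalIntegral.integral_const, smul_eq_mul, hs', mul_comm]
    rw [← this]
    refine intervalIntegral.integral_mono_on hxy (continuous_const.intervalIntegrable _ _) (hii _ _)
      fun z hz' => pow_le_pow_left₀ (by positivity) ?_ 3
    have h1 := hL θ z
    have h2 : C' * (N : ℝ) ^ 2 * |θ - z| ≤ C' * (N : ℝ) ^ 2 * s :=
      mul_le_mul_of_nonneg_left (hz z hz') (by positivity)
    have h3 : C' * (N : ℝ) ^ 2 * s = ω * N / 2 := by rw [hs]; field_simp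
    linarith
  have hj : ∀ j ∈ J, (ω * N / 2) ^ 3 * s ≤
      ∫ θ in ((j : ℝ) / N)..(((j + 1 : ℕ) : ℝ) / N), F θ ^ 3 := by
    intro j hj
    obtain ⟨θ, ⟨hθ1, hθ2⟩, hθ⟩ := (mem_filter.1 hj).2
    have hlen : ((j + 1 : ℕ) : ℝ) / N = j / N + 1 / N := by push_cast; rw [add_div]
    rw [hlen] at hθ2 ⊢
    have hsub : ∀ x y : ℝ, (j : ℝ) / N ≤ x → x ≤ y → y ≤ j / N + 1 / N →
        ∫ θ in x..y, F θ ^ 3 ≤ ∫ θ in ((j : ℝ) / N)..(j / N + 1 / N), F θ ^ 3 :=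
      fun x y h1 h2 h3 => intervalIntegral.integral_mono_interval h1 h2 h3
        (Filter.Eventually.of_forall fun θ => by have := hF0 θ; positivity) (hii _ _)
    by_cases hc : θ + s ≤ j / N + 1 / N
    · refine (hloc θ (θ + s) (by linarith) (by ring) ⟨θ, hθ, fun z hz => ?_⟩).trans
        (hsub _ _ hθ1 (by linarith) hc)
      rw [abs_le]; constructor <;> linarith [hz.1, hz.2]
    · refine (hloc (θ - s) θ (by linarith) (by ring) ⟨θ, hθ, fun z hz => ?_⟩).trans
        (hsub _ _ (by linarith) (by linarith) hθ2)
      rw [abs_le]; constructor <;> linarith [hz.1, hz.2]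
  have htot : (#J : ℝ) * ((ω * N / 2) ^ 3 * s) ≤ C * (N : ℝ) ^ 2 := by
    refine le_trans ?_ hI
    have h1 := intervalIntegral.sum_integral_adjacent_intervals (f := fun θ => F θ ^ 3)
      (μ := MeasureTheory.volume) (a := fun j : ℕ => (j : ℝ) / N) (n := N) fun k _ => hii _ _
    rw [Nat.cast_zero, zero_div, div_self hN'.ne'] at h1
    rw [← h1, ← nsmul_eq_mul, ← sum_const]
    refine (sum_le_sum hj).trans (sum_le_sum_of_subset_of_nonneg (filter_subset _ _) fun j _ _ => ?_)
    exact intervalIntegral.integral_nonneg (by gcongr; simp) fun θ _ => by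
      have := hF0 θ; positivity
  rw [le_div_iff₀ (by positivity)]
  refine le_of_mul_le_mul_right ?_ (by positivity : 0 < (N : ℝ) ^ 2)
  refine le_trans (le_of_eq ?_) htot
  rw [hs]; field_simp

/-- Dirichlet's pigeonhole argument: many multiples of `Q` up to `w` whose differences are
almost integral at each of the frequencies `x j`. -/
lemma exists_almost_period (J : Finset ℕ) (x : ℕ → ℝ) {Q M : ℕ} (hQ : 0 < Q) (hM : 0 < M) (w : ℕ) :
    ∃ B : Finset ℤ, B ⊆ Icc 0 (w : ℤ) ∧ (∀ b ∈ B, (Q : ℤ) ∣ b) ∧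
      (((w / Q + 1 : ℕ) : ℝ) / (M : ℝ) ^ #J ≤ #B) ∧
      ∀ j ∈ J, ∀ b ∈ B, ∀ b' ∈ B, ∃ z : ℤ, |(b' - b : ℤ) * x j - z| ≤ 1 / M := by
  have hM' : (0 : ℝ) < M := by exact_mod_cast hM
  -- Each fractional part is recorded up to `1 / M`. Two multiples in the same fibre have
  -- differences almost integral at every frequency, and some fibre has at least average size.
  set φ : ℕ → (J → Fin M) := fun y j => ⟨⌊M * Int.fract ((Q * y : ℕ) * x j)⌋₊, by
    rw [Nat.floor_lt (mul_nonneg hM'.le (Int.fract_nonneg _))]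
    exact mul_lt_of_lt_one_right hM' (Int.fract_lt_one _)⟩ with hφ
  have : Nonempty (J → Fin M) := ⟨fun _ => ⟨0, hM⟩⟩
  obtain ⟨c, -, hc⟩ := exists_le_card_fiber_of_nsmul_le_card_of_maps_to (s := range (w / Q + 1))
    (t := (univ : Finset (J → Fin M))) (f := φ) (b := ((w / Q + 1 : ℕ) : ℝ) / (M : ℝ) ^ #J)
    (fun _ _ => mem_univ _) univ_nonempty (by
      rw [card_range, card_univ, nsmul_eq_mul, Fintype.card_fun, Fintype.card_fin,
        Fintype.card_coe, Nat.cast_pow, mul_div_cancel₀ _ (by positivity)])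
  have hinj : Function.Injective fun y : ℕ => ((Q * y : ℕ) : ℤ) := fun y y' h =>
    Nat.eq_of_mul_eq_mul_left hQ (Nat.cast_injective (R := ℤ) h)
  refine ⟨image (fun y : ℕ => ((Q * y : ℕ) : ℤ)) {y ∈ range (w / Q + 1) | φ y = c}, ?_, ?_, ?_, ?_⟩
  · intro b hb
    obtain ⟨y, hy, rfl⟩ := mem_image.1 hb
    have h1 := mem_range.1 (mem_filter.1 hy).1
    have h2 : Q * y ≤ w := (Nat.mul_le_mul_left Q (Nat.le_of_lt_succ h1)).trans (Nat.mul_div_le w Q)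
    exact mem_Icc.2 ⟨by positivity, by exact_mod_cast h2⟩
  · intro b hb
    obtain ⟨y, -, rfl⟩ := mem_image.1 hb
    exact ⟨y, by push_cast; rfl⟩
  · rwa [card_image_of_injective _ hinj]
  · intro j hj b hb b' hb'
    obtain ⟨y, hy, rfl⟩ := mem_image.1 hb
    obtain ⟨y', hy', rfl⟩ := mem_image.1 hb'
    have h1 : φ y' = φ y := (mem_filter.1 hy').2.trans (mem_filter.1 hy).2.symm
    have h2 := congrArg Fin.val (congrFun h1 ⟨j, hj⟩)
    simp only [hφ] at h2
    refine ⟨⌊((Q * y' : ℕ) : ℝ) * x j⌋ - ⌊((Q * y : ℕ) : ℝ) * x j⌋, ?_⟩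
    have h3 : ∀ z z' : ℝ, 0 ≤ z → 0 ≤ z' → ⌊z⌋₊ = ⌊z'⌋₊ → |z - z'| ≤ 1 := by
      intro z z' hz hz' h
      have a1 := Nat.floor_le hz
      have a2 := Nat.lt_floor_add_one z
      have a3 := Nat.floor_le hz'
      have a4 := Nat.lt_floor_add_one z'
      rw [h] at a1 a2
      rw [abs_le]; constructor <;> linarith
    have h4 := h3 _ _ (mul_nonneg hM'.le (Int.fract_nonneg _))
      (mul_nonneg hM'.le (Int.fract_nonneg _)) h2
    rw [← mul_sub, abs_mul, abs_of_pos hM'] at h4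
    rw [le_div_iff₀ hM', mul_comm]
    refine le_trans (le_of_eq ?_) h4
    congr 2
    rw [← Int.self_sub_floor, ← Int.self_sub_floor]
    push_cast
    ring

lemma exists_mem_Icc_div {N : ℕ} (hN : N ≠ 0) {θ : ℝ} (hθ : θ ∈ Set.Icc (0 : ℝ) 1) :
    ∃ j ∈ range N, θ ∈ Set.Icc ((j : ℝ) / N) (((j + 1 : ℕ) : ℝ) / N) := by
  have hN' : (0 : ℝ) < N := by exact_mod_cast Nat.pos_of_ne_zero hN
  rcases hθ.2.eq_or_lt with h | h
  · refine ⟨N - 1, mem_range.2 (by omega), ?_⟩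
    rw [Nat.sub_add_cancel (Nat.pos_of_ne_zero hN), div_self hN'.ne', h]
    refine ⟨?_, le_rfl⟩
    rw [div_le_one hN']
    exact_mod_cast Nat.sub_le N 1
  · have h0 : 0 ≤ θ * N := mul_nonneg hθ.1 hN'.le
    refine ⟨⌊θ * N⌋₊, mem_range.2 ((Nat.floor_lt h0).2 (by nlinarith)), ?_, ?_⟩
    · rw [div_le_iff₀ hN']; exact Nat.floor_le h0
    · rw [le_div_iff₀ hN']; push_cast; exact (Nat.lt_floor_add_one _).le

lemma sum_le_of_isPseudorandom {N : ℕ} (hN : N ≠ 0) {η : ℝ} (hη : η ≤ 1) {ν a : ℕ → ℝ}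
    (ha : ∀ n ∈ Icc 1 N, 0 ≤ a n ∧ a n ≤ ν n) (hν : IsPseudorandom η N ν) :
    ∑ n ∈ Icc 1 N, a n ≤ 2 * N := by
  have hN' : (0 : ℝ) < N := by exact_mod_cast Nat.pos_of_ne_zero hN
  have h1 := hν 0 (Nat.pos_of_ne_zero hN)
  have h2 : fourierSum N ν (((0 : ℕ) : ℝ) / N) = ((∑ n ∈ Icc 1 N, ν n : ℝ) : ℂ) := by
    simp [fourierSum]
  rw [h2, if_pos rfl] at h1
  have h3 : |∑ n ∈ Icc 1 N, ν n - N| ≤ η * N := by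
    rw [← Real.norm_eq_abs, ← Complex.norm_real]; push_cast at h1 ⊢; exact h1
  have h4 := (abs_le.1 h3).2
  have h5 : ∑ n ∈ Icc 1 N, a n ≤ ∑ n ∈ Icc 1 N, ν n := sum_le_sum fun n hn => (ha n hn).2
  nlinarith

/-- **Transference for one function.** A function with a pseudorandom majorant and an `L^q`
extension estimate is close in the Fourier sense to an almost bounded function, obtained by
averaging over multiples of `Q`. -/
theorem exists_smooth {Q : ℕ} (hQ : 0 < Q) {q K ω ε : ℝ} (hq : 2 < q) (hq3 : q < 3) (hω : 0 < ω)
    (hε : 0 < ε) : ∃ η₀ : ℝ, 0 < η₀ ∧ ∀ η : ℝ, 0 < η → η ≤ η₀ → ∀ N : ℕ, N ≠ 0 →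
      ∀ ν a : ℕ → ℝ, (∀ n ∈ Icc 1 N, 0 ≤ a n ∧ a n ≤ ν n) → IsPseudorandom η N ν →
        LqExtension q K N a → ∃ B : Finset ℤ, B.Nonempty ∧ B ⊆ Icc 0 (⌊ε * N⌋₊ : ℤ) ∧
          (∀ b ∈ B, (Q : ℤ) ∣ b) ∧ (∀ n, smooth B (ext N a) n ≤ 1 + ε) ∧
          (∀ θ, ‖fourierSum N a θ‖ ≤ 2 * N) ∧
          ∀ θ ∈ Set.Icc (0 : ℝ) 1, (1 - multiplier B θ) * ‖fourierSum N a θ‖ ≤ ω * N := by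
  classical
  wlog hω1 : ω ≤ 1 generalizing ω
  · obtain ⟨η₀, h0, h⟩ := this one_pos le_rfl
    refine ⟨η₀, h0, fun η hη hη' N hN ν a ha hν hL => ?_⟩
    obtain ⟨B, h1, h2, h3, h4, h5, h6⟩ := h η hη hη' N hN ν a ha hν hL
    refine ⟨B, h1, h2, h3, h4, h5, fun θ hθ => (h6 θ hθ).trans ?_⟩
    gcongr
    exact (not_le.1 hω1).le
  set C : ℝ := 2 ^ (3 - q) * |K| ^ q with hC
  set J₀ : ℝ := C / ((ω / 2) ^ 3 * (ω / (2 * (4 * Real.pi)))) with hJ₀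
  -- The phase errors `1 / M` and `w / N ≤ ε'` are each at most `ω / 26`. Together with the bound `2
  -- * N` on the transform they give `(4π/13) ω N ≤ ω N`. The cap `1 / 2` on `ε'` keeps `B` inside
  -- `[0, N)`.
  set M : ℕ := ⌈26 / ω⌉₊ with hM
  set ε' : ℝ := min (min ε (ω / 26)) (1 / 2) with hε'
  have hε'0 : 0 < ε' := by positivity
  have hε'1 : ε' ≤ ε := (min_le_left _ _).trans (min_le_left _ _)
  have hε'2 : ε' ≤ ω / 26 := (min_le_left _ _).trans (min_le_right _ _)
  have hε'3 : ε' ≤ 1 / 2 := min_le_right _ _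
  have hM0 : 0 < M := Nat.ceil_pos.2 (by positivity)
  have hM0' : (0 : ℝ) < M := by exact_mod_cast hM0
  have hM1 : (1 : ℝ) ≤ M := by exact_mod_cast hM0
  have hMω : 1 / (M : ℝ) ≤ ω / 26 := by
    rw [div_le_div_iff₀ hM0' (by norm_num), one_mul]
    have := Nat.le_ceil (26 / ω)
    rw [div_le_iff₀ hω] at this
    linarith
  have hQ' : (0 : ℝ) < Q := by exact_mod_cast hQ
  -- An upper bound for `N / #B` independent of `N`, available since the number of large intervals
  -- is bounded; it determines how small `η` must be.
  set H : ℝ := Q * (M : ℝ) ^ ⌊J₀⌋₊ / ε' with hH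
  have hH0 : 0 < H := by positivity
  refine ⟨min 1 (ε / (1 + H)), by positivity, fun η hη hη' N hN ν a ha hν hL => ?_⟩
  have hη1 : η ≤ 1 := hη'.trans (min_le_left _ _)
  have hη2 : η * (1 + H) ≤ ε := by
    rw [← le_div_iff₀ (by positivity)]; exact hη'.trans (min_le_right _ _)
  have hN' : (0 : ℝ) < N := by exact_mod_cast Nat.pos_of_ne_zero hN
  have ha0 : ∀ n, 0 ≤ ext N a n := ext_nonneg fun n hn => (ha n hn).1
  have hsum : ∑ n ∈ Icc (1 : ℤ) N, ext N a n ≤ 2 * N := by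
    rw [sum_Icc_intCast, sum_congr rfl fun n hn => ext_natCast hn a]
    exact sum_le_of_isPseudorandom hN hη1 ha hν
  have hF2 : ∀ θ, ‖fourierSum N a θ‖ ≤ 2 * N := fun θ => by
    rw [← expSum_ext]; exact (norm_expSum_le _ ha0 θ).trans hsum
  have hFc : Continuous fun θ => ‖fourierSum N a θ‖ := by
    simp_rw [← expSum_ext]; exact (continuous_expSum _ _).norm
  have hF3 : ∫ θ in (0 : ℝ)..1, ‖fourierSum N a θ‖ ^ 3 ≤ C * (N : ℝ) ^ 2 :=
    integral_pow_three_le hq hq3 two_pos hN hL hFc (fun _ => norm_nonneg _) (fun _ => le_rfl)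
      fun θ _ => hF2 θ
  have hFL : ∀ θ θ', ‖fourierSum N a θ‖ - ‖fourierSum N a θ'‖ ≤
      4 * Real.pi * (N : ℝ) ^ 2 * |θ - θ'| := by
    intro θ θ'
    rw [← expSum_ext, ← expSum_ext]
    refine (norm_sub_norm_le _ _).trans ((norm_expSum_sub_le ha0 θ θ').trans ?_)
    calc _ ≤ 2 * Real.pi * N * (2 * N) * |θ - θ'| := by gcongr
      _ = _ := by ring
  have hπ : ω ≤ 4 * Real.pi := by linarith [Real.pi_gt_three]
  have hJ := card_large_intervals_le hN hFc (fun _ => norm_nonneg _) hω hπ hFL hF3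
  rw [← hJ₀] at hJ
  set J := ({j ∈ range N | ∃ θ ∈ Set.Icc ((j : ℝ) / N) (((j + 1 : ℕ) : ℝ) / N),
    ω * N ≤ ‖fourierSum N a θ‖} : Finset ℕ) with hJdef
  have hJ1 : #J ≤ ⌊J₀⌋₊ := Nat.le_floor hJ
  have hx : ∀ j ∈ J, ∃ θ, θ ∈ Set.Icc ((j : ℝ) / N) (((j + 1 : ℕ) : ℝ) / N) := fun j hj => by
    obtain ⟨θ, hθ, -⟩ := (mem_filter.1 hj).2
    exact ⟨θ, hθ⟩
  choose! x hx using hx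
  obtain ⟨B, hB1, hB2, hB3, hB4⟩ := exists_almost_period J x hQ hM0 ⌊ε' * N⌋₊
  set w := ⌊ε' * N⌋₊ with hw
  have hwN : (w : ℝ) ≤ ε' * N := Nat.floor_le (by positivity)
  have hBcard : (N : ℝ) / H ≤ #B := by
    refine le_trans ?_ hB3
    have h1 : ε' * N / Q ≤ ((w / Q + 1 : ℕ) : ℝ) := by
      rw [div_le_iff₀ hQ']
      refine (Nat.lt_floor_add_one (ε' * N)).le.trans ?_
      rw [← hw]
      have : w + 1 ≤ (w / Q + 1) * Q := by
        have := Nat.lt_div_mul_add (a := w) hQ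
        rw [add_mul, one_mul]; omega
      exact_mod_cast this
    have h2 : (N : ℝ) / H = ε' * N / Q / (M : ℝ) ^ ⌊J₀⌋₊ := by rw [hH]; field_simp
    rw [h2]
    gcongr
  have hBpos : (0 : ℝ) < #B := lt_of_lt_of_le (by positivity) hBcard
  have hBne : B.Nonempty := card_pos.1 (by exact_mod_cast hBpos)
  have hwlt : w < N := by
    have : (w : ℝ) < N := by nlinarith
    exact_mod_cast this
  have hwle : w ≤ ⌊ε * N⌋₊ := Nat.floor_le_floor (by gcongr)
  refine ⟨B, hBne, hB1.trans (Icc_subset_Icc le_rfl (by exact_mod_cast hwle)), hB2, fun n => ?_,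
    hF2, fun θ hθ => ?_⟩
  · refine (smooth_ext_le hN (fun b hb => ?_) hBne hη.le ha hν n).trans ?_
    · have := mem_Icc.1 (hB1 hb)
      exact mem_Ico.2 (by omega)
    · have h1 : (N : ℝ) / #B ≤ H := by
        rw [div_le_iff₀ hBpos]
        rw [div_le_iff₀ hH0] at hBcard
        linarith
      have := mul_le_mul_of_nonneg_left h1 hη.le
      linarith
  -- At a large frequency the multiplier is close to `1`; at any other the transform itself is small
  -- enough.
  · by_cases hθω : ω * N ≤ ‖fourierSum N a θ‖
    · obtain ⟨j, hjN, hj⟩ := exists_mem_Icc_div hN hθ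
      have hjJ : j ∈ J := mem_filter.2 ⟨hjN, θ, hj, hθω⟩
      have h1 : 1 - multiplier B θ ≤ 2 * Real.pi * (ω / 13) := by
        refine one_sub_multiplier_le hBne fun b hb b' hb' => ?_
        obtain ⟨z, hz⟩ := hB4 j hjJ b hb b' hb'
        refine (norm_e_sub_one_le_of_int _ z).trans ?_
        have h2 : |((b' - b : ℤ) : ℝ)| ≤ w := by
          have h3 := mem_Icc.1 (hB1 hb)
          have h4 := mem_Icc.1 (hB1 hb')
          have : |b' - b| ≤ (w : ℤ) := abs_le.2 (by omega)
          exact_mod_cast this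
        have h3 : |θ - x j| ≤ 1 / N := by
          have h4 := hx j hjJ
          have h5 : ((j + 1 : ℕ) : ℝ) / N = j / N + 1 / N := by push_cast; rw [add_div]
          rw [h5] at h4 hj
          rw [abs_le]
          constructor <;> linarith [h4.1, h4.2, hj.1, hj.2]
        have h4 : ((b' - b : ℤ) : ℝ) * θ - z =
            (((b' - b : ℤ) : ℝ) * x j - z) + ((b' - b : ℤ) : ℝ) * (θ - x j) := by ring
        have h5 : |((b' - b : ℤ) : ℝ) * (θ - x j)| ≤ ω / 26 := by
          rw [abs_mul]
          calc _ ≤ (w : ℝ) * (1 / N) := by gcongr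
            _ ≤ ε' * N * (1 / N) := by gcongr
            _ = ε' := by field_simp
            _ ≤ _ := hε'2
        have h6 := abs_add_le (((b' - b : ℤ) : ℝ) * x j - z) (((b' - b : ℤ) : ℝ) * (θ - x j))
        rw [← h4] at h6
        gcongr
        linarith
      calc _ ≤ 2 * Real.pi * (ω / 13) * (2 * N) :=
            mul_le_mul h1 (hF2 θ) (norm_nonneg _) (by positivity)
        _ = (4 * Real.pi / 13) * (ω * N) := by ring
        _ ≤ 1 * (ω * N) := by
            gcongr
            rw [div_le_one (by norm_num)]
            linarith [Real.pi_lt_d2]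
        _ = _ := one_mul _
    · calc _ ≤ 1 * ‖fourierSum N a θ‖ := by
            gcongr
            linarith [multiplier_nonneg B θ]
        _ ≤ _ := by rw [one_mul]; exact (not_le.1 hθω).le

/-! ### The counting lemma -/

/-- The weighted number of solutions of `x + y + z = N` with `x ∈ S 0`, `y ∈ S 1`, `z ∈ S 2`. -/
noncomputable def tripleSum (N : ℤ) (S : Fin 3 → Finset ℤ) (f : Fin 3 → ℤ → ℝ) : ℝ :=
  ∑ x ∈ S 0, ∑ y ∈ S 1, ∑ z ∈ S 2, if x + y + z = N then f 0 x * f 1 y * f 2 z else 0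

lemma tripleSum_eq_integral (N : ℤ) (S : Fin 3 → Finset ℤ) (f : Fin 3 → ℤ → ℝ) :
    (tripleSum N S f : ℂ) = ∫ θ in (0 : ℝ)..1,
      expSum (S 0) (f 0) θ * expSum (S 1) (f 1) θ * expSum (S 2) (f 2) θ * e (-(N * θ)) := by
  have hpt : ∀ θ : ℝ,
      expSum (S 0) (f 0) θ * expSum (S 1) (f 1) θ * expSum (S 2) (f 2) θ * e (-(N * θ)) =
      ∑ x ∈ S 0, ∑ y ∈ S 1, ∑ z ∈ S 2,
        ((f 0 x * f 1 y * f 2 z : ℝ) : ℂ) * e ((x + y + z - N : ℤ) * θ) := by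
    intro θ
    rw [expSum, expSum, expSum, sum_mul_sum, sum_mul, sum_mul]
    refine sum_congr rfl fun x _ => ?_
    rw [sum_mul, sum_mul]
    refine sum_congr rfl fun y _ => ?_
    rw [mul_sum, sum_mul]
    refine sum_congr rfl fun z _ => ?_
    have : (((x + y + z - N : ℤ) : ℝ) * θ) = x * θ + y * θ + z * θ + -(N * θ) := by
      push_cast; ring
    rw [this, e_add, e_add, e_add]
    push_cast; ring
  have hii : ∀ (c : ℂ) (k : ℤ), IntervalIntegrable (fun θ : ℝ => c * e (k * θ))
      MeasureTheory.volume 0 1 := fun c k =>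
    (continuous_const.mul (continuous_e.comp
      (continuous_const.mul continuous_id))).intervalIntegrable _ _
  have hc : ∀ c : ℂ, ∀ k : ℤ, Continuous fun θ : ℝ => c * e (k * θ) := fun c k =>
    continuous_const.mul (continuous_e.comp (continuous_const.mul continuous_id))
  simp_rw [hpt]
  rw [intervalIntegral.integral_finsetSum fun x _ => (continuous_finsetSum _ fun y _ =>
    continuous_finsetSum _ fun z _ => hc _ _).intervalIntegrable _ _, tripleSum, Complex.ofReal_sum]
  refine sum_congr rfl fun x _ => ?_
  rw [intervalIntegral.integral_finsetSum fun y _ =>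
    (continuous_finsetSum _ fun z _ => hc _ _).intervalIntegrable _ _, Complex.ofReal_sum]
  refine sum_congr rfl fun y _ => ?_
  rw [intervalIntegral.integral_finsetSum fun z _ => (hc _ _).intervalIntegrable _ _,
    Complex.ofReal_sum]
  refine sum_congr rfl fun z _ => ?_
  rw [intervalIntegral.integral_const_mul, integral_e_mul]
  by_cases h : x + y + z = N
  · simp [h]
  · simp [h, sub_eq_zero]

/-- Weighted AM-GM, used in place of Hölder's inequality. The third factor will be the small one, so
`l` is taken small to trade the bounded moments against it. -/
lemma mul_mul_le_of_weight {x y z l : ℝ} (hx : 0 ≤ x) (hy : 0 ≤ y) (hz : 0 ≤ z) (hl : 0 < l) :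
    x * y * z ≤ (l ^ 3 * (x ^ 3 + y ^ 3) + (l ^ 6)⁻¹ * z ^ 3) / 3 := by
  have key : ∀ u v t : ℝ, 0 ≤ u → 0 ≤ v → 0 ≤ t → u * v * t ≤ (u ^ 3 + v ^ 3 + t ^ 3) / 3 := by
    intro u v t hu hv ht
    have : u ^ 3 + v ^ 3 + t ^ 3 - 3 * (u * v * t) =
        (u + v + t) * ((u - v) ^ 2 + (v - t) ^ 2 + (t - u) ^ 2) / 2 := by ring
    have h2 : 0 ≤ (u + v + t) * ((u - v) ^ 2 + (v - t) ^ 2 + (t - u) ^ 2) / 2 := by positivity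
    linarith
  have h := key (l * x) (l * y) ((l ^ 2)⁻¹ * z) (by positivity) (by positivity) (by positivity)
  have h1 : l * x * (l * y) * ((l ^ 2)⁻¹ * z) = x * y * z := by field_simp
  have h2 : (l * x) ^ 3 + (l * y) ^ 3 + ((l ^ 2)⁻¹ * z) ^ 3 =
      l ^ 3 * (x ^ 3 + y ^ 3) + (l ^ 6)⁻¹ * z ^ 3 := by field_simp
  rwa [h1, h2] at h

/-- The counting lemma: smoothing each function changes the number of solutions by an amount
controlled by third moments. -/
lemma abs_tripleSum_smooth_sub_le {N : ℤ} {n w : Fin 3 → ℕ} {f : Fin 3 → ℤ → ℝ}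
    {B : Fin 3 → Finset ℤ} (hB : ∀ i, B i ⊆ Icc 0 (w i : ℤ))
    (hf : ∀ i, ∀ x ∉ Icc (1 : ℤ) (n i), f i x = 0) {l : ℝ} (hl : 0 < l) {C c : ℝ}
    (hC : ∀ i, ∫ θ in (0 : ℝ)..1, ‖expSum (Icc (1 : ℤ) (n i)) (f i) θ‖ ^ 3 ≤ C)
    (hc : ∀ i, ∫ θ in (0 : ℝ)..1,
      ((1 - multiplier (B i) θ) * ‖expSum (Icc (1 : ℤ) (n i)) (f i) θ‖) ^ 3 ≤ c) :
    |tripleSum N (fun i => Icc (1 : ℤ) (n i)) f -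
      tripleSum N (fun i => Icc (1 - (w i : ℤ)) (n i + w i)) (fun i => smooth (B i) (f i))| ≤
      2 * l ^ 3 * C + (l ^ 6)⁻¹ * c := by
  set F : Fin 3 → ℝ → ℂ := fun i θ => expSum (Icc (1 : ℤ) (n i)) (f i) θ with hF
  have hFc : ∀ i, Continuous (F i) := fun i => continuous_expSum _ _
  set m : Fin 3 → ℝ → ℝ := fun i θ => multiplier (B i) θ with hm
  have hmc : ∀ i, Continuous (m i) := fun i => continuous_multiplier _
  have hm0 : ∀ i θ, 0 ≤ m i θ := fun i θ => multiplier_nonneg _ _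
  have hm1 : ∀ i θ, m i θ ≤ 1 := fun i θ => multiplier_le_one _ _
  have hec : Continuous fun θ : ℝ => e (-(N * θ)) :=
    continuous_e.comp (continuous_const.mul continuous_id).neg
  have hmC : ∀ i, Continuous fun θ => (m i θ : ℂ) := fun i =>
    Complex.continuous_ofReal.comp (hmc i)
  rw [← Real.norm_eq_abs, ← Complex.norm_real, Complex.ofReal_sub, tripleSum_eq_integral,
    tripleSum_eq_integral]
  simp_rw [expSum_smooth (hB _) (hf _)]
  change ‖(∫ θ in (0 : ℝ)..1, F 0 θ * F 1 θ * F 2 θ * e (-(N * θ))) -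
    ∫ θ in (0 : ℝ)..1, (m 0 θ * F 0 θ) * (m 1 θ * F 1 θ) * (m 2 θ * F 2 θ) * e (-(N * θ))‖ ≤ _
  have i₁ : Continuous fun θ => F 0 θ * F 1 θ * F 2 θ * e (-(N * θ)) :=
    (((hFc 0).mul (hFc 1)).mul (hFc 2)).mul hec
  have i₂ : Continuous fun θ =>
      (m 0 θ * F 0 θ) * (m 1 θ * F 1 θ) * (m 2 θ * F 2 θ) * e (-(N * θ)) :=
    ((((hmC 0).mul (hFc 0)).mul ((hmC 1).mul (hFc 1))).mul ((hmC 2).mul (hFc 2))).mul hec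
  rw [← intervalIntegral.integral_sub (i₁.intervalIntegrable _ _) (i₂.intervalIntegrable _ _)]
  set X : Fin 3 → ℝ → ℝ := fun i θ => ‖F i θ‖ ^ 3 with hX
  set Y : Fin 3 → ℝ → ℝ := fun i θ => ((1 - m i θ) * ‖F i θ‖) ^ 3 with hY
  have hXi : ∀ i (r : ℝ), IntervalIntegrable (fun θ => r * X i θ) MeasureTheory.volume 0 1 :=
    fun i r => (continuous_const.mul ((hFc i).norm.pow 3)).intervalIntegrable _ _
  have hYi : ∀ i (r : ℝ), IntervalIntegrable (fun θ => r * Y i θ) MeasureTheory.volume 0 1 :=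
    fun i r => (continuous_const.mul (((continuous_const.sub (hmc i)).mul
      (hFc i).norm).pow 3)).intervalIntegrable _ _
  have hpt : ∀ θ, ‖F 0 θ * F 1 θ * F 2 θ * e (-(N * θ)) -
      (m 0 θ * F 0 θ) * (m 1 θ * F 1 θ) * (m 2 θ * F 2 θ) * e (-(N * θ))‖ ≤
      ∑ i, (2 * l ^ 3 / 3 * X i θ + (l ^ 6)⁻¹ / 3 * Y i θ) := by
    intro θ
    have h1 : F 0 θ * F 1 θ * F 2 θ * e (-(N * θ)) -
        (m 0 θ * F 0 θ) * (m 1 θ * F 1 θ) * (m 2 θ * F 2 θ) * e (-(N * θ)) =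
        ((1 - m 0 θ * m 1 θ * m 2 θ : ℝ) : ℂ) * (F 0 θ * F 1 θ * F 2 θ * e (-(N * θ))) := by
      push_cast; ring
    have h01 : m 0 θ * m 1 θ ≤ 1 := mul_le_one₀ (hm1 0 θ) (hm0 1 θ) (hm1 1 θ)
    have h2 : 0 ≤ 1 - m 0 θ * m 1 θ * m 2 θ :=
      sub_nonneg.2 (mul_le_one₀ h01 (hm0 2 θ) (hm1 2 θ))
    -- A union bound: the total defect is at most the sum of the individual ones, so each resulting
    -- term has one small factor.
    have h3 : 1 - m 0 θ * m 1 θ * m 2 θ ≤ (1 - m 0 θ) + (1 - m 1 θ) + (1 - m 2 θ) := by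
      have e1 : 0 ≤ (1 - m 0 θ) * (1 - m 1 θ) :=
        mul_nonneg (sub_nonneg.2 (hm1 0 θ)) (sub_nonneg.2 (hm1 1 θ))
      have e2 : 0 ≤ (1 - m 0 θ * m 1 θ) * (1 - m 2 θ) :=
        mul_nonneg (sub_nonneg.2 h01) (sub_nonneg.2 (hm1 2 θ))
      linarith
    rw [h1, norm_mul, Complex.norm_real, Real.norm_of_nonneg h2, norm_mul, norm_e, mul_one,
      norm_mul, norm_mul]
    have h4 := mul_le_mul_of_nonneg_right h3
      (by positivity : 0 ≤ ‖F 0 θ‖ * ‖F 1 θ‖ * ‖F 2 θ‖)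
    have hy : ∀ i, 0 ≤ (1 - m i θ) * ‖F i θ‖ := fun i =>
      mul_nonneg (sub_nonneg.2 (hm1 i θ)) (norm_nonneg _)
    have k0 := mul_mul_le_of_weight (norm_nonneg (F 1 θ)) (norm_nonneg (F 2 θ)) (hy 0) hl
    have k1 := mul_mul_le_of_weight (norm_nonneg (F 0 θ)) (norm_nonneg (F 2 θ)) (hy 1) hl
    have k2 := mul_mul_le_of_weight (norm_nonneg (F 0 θ)) (norm_nonneg (F 1 θ)) (hy 2) hl
    rw [Fin.sum_univ_three]
    simp only [hX, hY]
    linarith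
  have hlim : ∀ i, ∫ θ in (0 : ℝ)..1, (2 * l ^ 3 / 3 * X i θ + (l ^ 6)⁻¹ / 3 * Y i θ) ≤
      2 * l ^ 3 / 3 * C + (l ^ 6)⁻¹ / 3 * c := by
    intro i
    rw [intervalIntegral.integral_add (hXi i _) (hYi i _), intervalIntegral.integral_const_mul,
      intervalIntegral.integral_const_mul]
    exact add_le_add (mul_le_mul_of_nonneg_left (hC i) (by positivity))
      (mul_le_mul_of_nonneg_left (hc i) (by positivity))
  refine (intervalIntegral.norm_integral_le_of_norm_le zero_le_one
    (Filter.Eventually.of_forall fun θ _ => hpt θ) ?_).trans ?_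
  · exact (continuous_finsetSum _ fun i _ => (continuous_const.mul ((hFc i).norm.pow 3)).add
      (continuous_const.mul (((continuous_const.sub (hmc i)).mul
        (hFc i).norm).pow 3))).intervalIntegrable _ _
  · rw [intervalIntegral.integral_finsetSum fun i _ => (hXi i _).add (hYi i _)]
    refine (sum_le_sum fun i _ => hlim i).trans (le_of_eq ?_)
    rw [sum_const, card_univ, Fintype.card_fin]
    ring

/-! ### From smoothed functions to level sets and residue classes -/

/-- Transference for one function, in terms of third moments. -/
theorem exists_smooth_third_moment {Q : ℕ} (hQ : 0 < Q) {q K ρ ε : ℝ} (hq : 2 < q) (hq3 : q < 3)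
    (hρ : 0 < ρ) (hε : 0 < ε) : ∃ η₀ : ℝ, 0 < η₀ ∧ ∀ η : ℝ, 0 < η → η ≤ η₀ → ∀ N : ℕ, N ≠ 0 →
      ∀ ν a : ℕ → ℝ, (∀ n ∈ Icc 1 N, 0 ≤ a n ∧ a n ≤ ν n) → IsPseudorandom η N ν →
        LqExtension q K N a → ∃ B : Finset ℤ, B.Nonempty ∧ B ⊆ Icc 0 (⌊ε * N⌋₊ : ℤ) ∧
          (∀ b ∈ B, (Q : ℤ) ∣ b) ∧ (∀ n, smooth B (ext N a) n ≤ 1 + ε) ∧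
          ∑ n ∈ Icc (1 : ℤ) N, ext N a n ≤ 2 * N ∧
          (∫ θ in (0 : ℝ)..1, ‖expSum (Icc (1 : ℤ) N) (ext N a) θ‖ ^ 3 ≤
            2 ^ (3 - q) * |K| ^ q * (N : ℝ) ^ 2) ∧
          (∫ θ in (0 : ℝ)..1,
            ((1 - multiplier B θ) * ‖expSum (Icc (1 : ℤ) N) (ext N a) θ‖) ^ 3 ≤
            ρ * (N : ℝ) ^ 2) := by
  -- Chosen to solve `ω ^ (3 - q) * (|K| ^ q + 1) = ρ`; the added `1` avoids division by zero.
  set ω : ℝ := (ρ / (|K| ^ q + 1)) ^ (1 / (3 - q)) with hω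
  have hKq : 0 ≤ |K| ^ q := by positivity
  have hω0 : 0 < ω := by positivity
  have hωρ : ω ^ (3 - q) * |K| ^ q ≤ ρ := by
    rw [hω, ← Real.rpow_mul (by positivity), one_div_mul_cancel (by linarith), Real.rpow_one,
      div_mul_eq_mul_div, div_le_iff₀ (by positivity)]
    linarith
  obtain ⟨η₀, h0, h⟩ := exists_smooth (K := K) hQ hq hq3 hω0 hε
  refine ⟨min η₀ 1, by positivity, fun η hη hη' N hN ν a ha hν hL => ?_⟩
  obtain ⟨B, h1, h2, h3, h4, h5, h6⟩ := h η hη (hη'.trans (min_le_left _ _)) N hN ν a ha hν hL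
  have hFc : Continuous fun θ => ‖fourierSum N a θ‖ := by
    simp_rw [← expSum_ext]; exact (continuous_expSum _ _).norm
  refine ⟨B, h1, h2, h3, h4, ?_, ?_, ?_⟩
  · rw [sum_Icc_intCast, sum_congr rfl fun n hn => ext_natCast hn a]
    exact sum_le_of_isPseudorandom hN (hη'.trans (min_le_right _ _)) ha hν
  · simp_rw [expSum_ext]
    exact integral_pow_three_le hq hq3 two_pos hN hL hFc (fun _ => norm_nonneg _) (fun _ => le_rfl)
      fun θ _ => h5 θ
  · simp_rw [expSum_ext]
    refine (integral_pow_three_le hq hq3 hω0 hN hL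
      (F := fun θ => (1 - multiplier B θ) * ‖fourierSum N a θ‖) ((continuous_const.sub (continuous_multiplier B)).mul hFc)
      (fun θ => mul_nonneg (sub_nonneg.2 (multiplier_le_one _ _)) (norm_nonneg _)) (fun θ => ?_)
      h6).trans (mul_le_mul_of_nonneg_right hωρ (by positivity))
    exact mul_le_of_le_one_left (norm_nonneg _) (by linarith [multiplier_nonneg B θ])

/-- For every pair `b, b'` the translate of `X` by `b' - b` lies in `X'`, so the mass of `f` on `X`
is recovered for each term of the average. -/
lemma sum_le_sum_smooth {B X X' : Finset ℤ} (hB : B.Nonempty) {f : ℤ → ℝ} (hf : ∀ n, 0 ≤ f n)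
    (h : ∀ x ∈ X, ∀ b ∈ B, ∀ b' ∈ B, x - (b - b') ∈ X') :
    ∑ x ∈ X, f x ≤ ∑ x ∈ X', smooth B f x := by
  have hc : (0 : ℝ) < #B := by exact_mod_cast hB.card_pos
  unfold smooth
  rw [← sum_div, le_div_iff₀ (by positivity), sum_comm]
  have h1 : (∑ x ∈ X, f x) * (#B : ℝ) ^ 2 = ∑ b ∈ B, ∑ b' ∈ B, ∑ x ∈ X, f x := by
    simp only [sum_const, nsmul_eq_mul]; ring
  rw [h1]
  refine sum_le_sum fun b hb => ?_
  rw [sum_comm (s := X')]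
  refine sum_le_sum fun b' hb' => ?_
  calc ∑ x ∈ X, f x = ∑ y ∈ X.image (· - (b - b')), f (y + b - b') := by
        rw [sum_image fun x _ y _ hxy => sub_left_injective hxy]
        refine sum_congr rfl fun x _ => ?_
        congr 1; ring
    _ ≤ ∑ y ∈ X', f (y + b - b') := by
        refine sum_le_sum_of_subset_of_nonneg ?_ fun _ _ _ => hf _
        intro y hy
        obtain ⟨x, hx, rfl⟩ := mem_image.1 hy
        exact h x hx b hb b' hb'

/-- The level set of an almost bounded function has at least about as many elements as its sum. -/
lemma sum_sub_le_card_level {N w : ℕ} {ε : ℝ} (hε : 0 ≤ ε) (hε1 : ε ≤ 1) (hw : (w : ℝ) ≤ ε * N)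
    {g : ℤ → ℝ} (hg : ∀ n, g n ≤ 1 + ε) {X : Finset ℤ} (hX : X ⊆ Icc (1 - (w : ℤ)) (N + w)) :
    ∑ n ∈ X, g n - 6 * ε * N ≤ #{n ∈ X | n ∈ Icc (1 : ℤ) N ∧ ε ≤ g n} := by
  -- The total loss `6εN` consists of `εN` from values up to `1 + ε`, `4εN` from at most `2w` points
  -- outside `[1, N]`, and `εN` from points below the level.
  have h1 : ∀ n ∈ X, g n ≤ (1 + ε) * (if n ∈ Icc (1 : ℤ) N ∧ ε ≤ g n then 1 else 0) +
      ((1 + ε) * (if n ∉ Icc (1 : ℤ) N then 1 else 0) + ε * if n ∈ Icc (1 : ℤ) N then 1 else 0) := by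
    intro n _
    by_cases h : n ∈ Icc (1 : ℤ) N
    · by_cases h' : ε ≤ g n
      · simp only [h, h', and_self, if_true, not_true, if_false]
        linarith [hg n]
      · simp only [h, h', and_false, if_true, not_true, if_false]
        linarith [not_le.1 h']
    · simp only [h, false_and, if_true, not_false_iff, if_false]
      linarith [hg n]
  have h2 := sum_le_sum h1
  simp only [sum_add_distrib, ← mul_sum, sum_boole] at h2
  set k : ℝ := ((#{n ∈ X | n ∈ Icc (1 : ℤ) N ∧ ε ≤ g n} : ℕ) : ℝ)
  have c1 : (#{n ∈ X | n ∈ Icc (1 : ℤ) N} : ℝ) ≤ N := by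
    have : #{n ∈ X | n ∈ Icc (1 : ℤ) N} ≤ #(Icc (1 : ℤ) N) :=
      card_le_card fun n hn => (mem_filter.1 hn).2
    rw [Int.card_Icc] at this
    exact_mod_cast this.trans (by omega)
  have c2 : (#{n ∈ X | n ∉ Icc (1 : ℤ) N} : ℝ) ≤ 2 * w := by
    have : #{n ∈ X | n ∉ Icc (1 : ℤ) N} ≤ #(Icc (1 - (w : ℤ)) 0 ∪ Icc ((N : ℤ) + 1) (N + w)) := by
      refine card_le_card fun n hn => ?_
      obtain ⟨h3, h4⟩ := mem_filter.1 hn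
      have h5 := mem_Icc.1 (hX h3)
      simp only [mem_union, mem_Icc] at h4 ⊢
      omega
    have := this.trans (card_union_le _ _)
    rw [Int.card_Icc, Int.card_Icc] at this
    exact_mod_cast this.trans (by omega)
  have c3 : k ≤ N := by
    refine le_trans ?_ c1
    refine Nat.cast_le.2 (card_le_card fun n hn => ?_)
    exact mem_filter.2 ⟨(mem_filter.1 hn).1, (mem_filter.1 hn).2.1⟩
  have k1 : ε * k ≤ ε * N := by gcongr
  have k2 : (1 + ε) * (#{n ∈ X | n ∉ Icc (1 : ℤ) N} : ℝ) ≤ 2 * (2 * (ε * N)) :=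
    mul_le_mul (by linarith) (by linarith) (by positivity) (by norm_num)
  have k3 : ε * (#{n ∈ X | n ∈ Icc (1 : ℤ) N} : ℝ) ≤ ε * N := by gcongr
  linarith

lemma solutionSum_eq_tripleSum (N : ℕ) (a : Fin 3 → ℕ → ℝ) :
    solutionSum N a =
      tripleSum N (fun i => Icc (1 : ℤ) (len N i)) (fun i => ext (len N i) (a i)) := by
  rw [tripleSum]
  simp_rw [sum_Icc_intCast]
  rw [solutionSum, sum_filter]
  have h1 : ∀ x ∈ Icc 1 (len N 0), ∀ y ∈ Icc 1 (len N 1), ∀ z ∈ Icc 1 (len N 2),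
      (if (x : ℤ) + y + z = N then ext (len N 0) (a 0) x * ext (len N 1) (a 1) y *
        ext (len N 2) (a 2) z else 0) =
      if x + y + z = N then a 0 x * a 1 y * a 2 z else 0 := by
    intro x hx y hy z hz
    rw [ext_natCast hx, ext_natCast hy, ext_natCast hz]
    refine if_congr ?_ rfl rfl
    exact_mod_cast Iff.rfl
  rw [sum_congr rfl fun x hx => sum_congr rfl fun y hy => sum_congr rfl fun z hz =>
    h1 x hx y hy z hz]
  simp_rw [← sum_product']
  refine sum_bij' (fun n _ => (n 0, n 1, n 2)) (fun p _ => ![p.1, p.2.1, p.2.2]) ?_ ?_ ?_ ?_ ?_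
  · intro n hn
    rw [Fintype.mem_piFinset] at hn
    exact mem_product.2 ⟨hn 0, mem_product.2 ⟨hn 1, hn 2⟩⟩
  · rintro ⟨x, y, z⟩ hp
    rw [mem_product, mem_product] at hp
    rw [Fintype.mem_piFinset]
    intro i
    fin_cases i
    exacts [hp.1, hp.2.1, hp.2.2]
  · intro n _
    ext i
    fin_cases i <;> rfl
  · intros; rfl
  · intros; rfl

open Classical in
/-- Regularity provides two residue classes whose difference is coprime to `P(β⁻¹)`, in which `f`
has much mass near the two ends of the interval. -/
lemma exists_residues_of_isRegular {β κ : ℝ} (hκ : 0 < κ) {N : ℕ} (hN : N ≠ 0) {f : ℕ → ℝ}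
    (hf : ∀ n ∈ Icc 1 N, 0 ≤ f n) (hs : ∑ n ∈ Icc (1 : ℤ) N, ext N f n ≤ 2 * N)
    (h : IsRegular β κ N f) :
    ∃ b b' : ℤ, Int.gcd (b' - b) (primeProd β⁻¹) = 1 ∧
      κ / (2 * (primeProd β⁻¹ : ℝ) ^ 2) * N ≤
        ∑ n ∈ Icc (1 : ℤ) N with ((n : ℤ) : ℝ) ≤ β * N ∧ n ≡ b [ZMOD primeProd β⁻¹], ext N f n ∧
      κ / (2 * (primeProd β⁻¹ : ℝ) ^ 2) * N ≤
        ∑ n ∈ Icc (1 : ℤ) N with (1 - β) * N ≤ ((n : ℤ) : ℝ) ∧ n ≡ b' [ZMOD primeProd β⁻¹], ext N f n := by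
  have hN' : (0 : ℝ) < N := by exact_mod_cast Nat.pos_of_ne_zero hN
  set Q := primeProd β⁻¹ with hQ
  have hQ0 : 0 < Q := primorial_pos _
  have hQ0' : (0 : ℝ) < Q := by exact_mod_cast hQ0
  have hf0 : ∀ n, 0 ≤ ext N f n := ext_nonneg hf
  rw [IsRegular, ← hQ] at h
  set S := (Icc 1 N ×ˢ Icc 1 N).filter (fun p : ℕ × ℕ => (p.1 : ℝ) ≤ β * N ∧
    (1 - β) * N ≤ (p.2 : ℝ) ∧ Int.gcd ((p.2 : ℤ) - (p.1 : ℤ)) (Q : ℤ) = 1) with hS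
  have hmaps : ∀ p ∈ S, (p.1 % Q, p.2 % Q) ∈ range Q ×ˢ range Q := fun p _ =>
    mem_product.2 ⟨mem_range.2 (Nat.mod_lt _ hQ0), mem_range.2 (Nat.mod_lt _ hQ0)⟩
  rw [← sum_fiberwise_of_maps_to hmaps] at h
  -- The mass is shared among the `Q²` pairs of residues, and some pair receives at least its share.
  have hc : κ * (N : ℝ) ^ 2 = ∑ _r ∈ range Q ×ˢ range Q, κ / (Q : ℝ) ^ 2 * (N : ℝ) ^ 2 := by
    rw [sum_const, card_product, card_range, nsmul_eq_mul]
    push_cast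
    field_simp
  rw [hc] at h
  obtain ⟨⟨b, b'⟩, -, hr⟩ := exists_le_of_sum_le
    (⟨(0, 0), mem_product.2 ⟨mem_range.2 hQ0, mem_range.2 hQ0⟩⟩) h
  set S' := S.filter fun p => (p.1 % Q, p.2 % Q) = (b, b') with hS'
  set U := ∑ n ∈ Icc (1 : ℤ) N with ((n : ℤ) : ℝ) ≤ β * N ∧ n ≡ b [ZMOD Q], ext N f n with hU
  set V := ∑ n ∈ Icc (1 : ℤ) N with (1 - β) * N ≤ ((n : ℤ) : ℝ) ∧ n ≡ b' [ZMOD Q], ext N f n with hV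
  have hpos : 0 < κ / (Q : ℝ) ^ 2 * (N : ℝ) ^ 2 := by positivity
  have hmod : ∀ p ∈ S', (p.1 : ℤ) ≡ b [ZMOD Q] ∧ (p.2 : ℤ) ≡ b' [ZMOD Q] := by
    intro p hp
    have h1 := (mem_filter.1 hp).2
    rw [Prod.mk.injEq] at h1
    rw [← h1.1, ← h1.2]
    push_cast
    exact ⟨(Int.mod_modEq _ _).symm, (Int.mod_modEq _ _).symm⟩
  have hne : S'.Nonempty := by
    rw [nonempty_iff_ne_empty]
    intro h0
    rw [h0, sum_empty] at hr
    linarith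
  have hUV : κ / (Q : ℝ) ^ 2 * (N : ℝ) ^ 2 ≤ U * V := by
    refine hr.trans ?_
    rw [hU, hV, sum_mul_sum, ← sum_product']
    have hinj : Function.Injective fun p : ℕ × ℕ => ((p.1 : ℤ), (p.2 : ℤ)) := fun p p' h => by
      simpa [Prod.ext_iff] using h
    have h1 : ∑ p ∈ S', f p.1 * f p.2 =
        ∑ p ∈ S'.image (fun p : ℕ × ℕ => ((p.1 : ℤ), (p.2 : ℤ))), ext N f p.1 * ext N f p.2 := by
      rw [sum_image hinj.injOn]
      refine sum_congr rfl fun p hp => ?_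
      have h2 := mem_product.1 (mem_filter.1 (mem_filter.1 hp).1).1
      rw [ext_natCast h2.1, ext_natCast h2.2]
    rw [h1]
    refine sum_le_sum_of_subset_of_nonneg ?_ fun p _ _ => mul_nonneg (hf0 _) (hf0 _)
    intro p hp
    obtain ⟨r, hr, rfl⟩ := mem_image.1 hp
    have h2 := mem_filter.1 (mem_filter.1 hr).1
    have h3 := mem_product.1 h2.1
    rw [mem_Icc, mem_Icc] at h3
    have h4 := hmod r hr
    simp only [mem_product, mem_filter, mem_Icc]
    refine ⟨⟨⟨by omega, by omega⟩, by exact_mod_cast h2.2.1, h4.1⟩,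
      ⟨⟨by omega, by omega⟩, by exact_mod_cast h2.2.2.1, h4.2⟩⟩
  have hU0 : 0 ≤ U := sum_nonneg fun _ _ => hf0 _
  have hV0 : 0 ≤ V := sum_nonneg fun _ _ => hf0 _
  have hU2 : U ≤ 2 * N :=
    (sum_le_sum_of_subset_of_nonneg (filter_subset _ _) fun _ _ _ => hf0 _).trans hs
  have hV2 : V ≤ 2 * N :=
    (sum_le_sum_of_subset_of_nonneg (filter_subset _ _) fun _ _ _ => hf0 _).trans hs
  -- A product bound becomes a bound for each factor, since either factor is at most `2 * N`.
  have heq : κ / (Q : ℝ) ^ 2 * (N : ℝ) ^ 2 = κ / (2 * (Q : ℝ) ^ 2) * N * (2 * N) := by field_simp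
  rw [heq] at hUV
  refine ⟨b, b', ?_, ?_, ?_⟩
  · obtain ⟨p, hp⟩ := hne
    have h1 := (mem_filter.1 (mem_filter.1 hp).1).2.2.2
    have h4 := hmod p hp
    rw [← h1]
    rw [← Int.gcd_emod, ← (h4.2.sub h4.1), Int.gcd_emod]
  · refine le_of_mul_le_mul_right (hUV.trans ?_) (by positivity : (0 : ℝ) < 2 * N)
    gcongr
  · refine le_of_mul_le_mul_right (hUV.trans ?_) (by positivity : (0 : ℝ) < 2 * N)
    rw [mul_comm]
    gcongr

/-- A lower bound for a weighted number of solutions in terms of level sets. -/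
lemma mul_sum_rep_le_tripleSum {N : ℤ} {S A : Fin 3 → Finset ℤ} {g : Fin 3 → ℤ → ℝ} {ε : ℝ}
    (hε : 0 ≤ ε) (hg : ∀ i n, 0 ≤ g i n) (hA : ∀ i, A i ⊆ S i) (hAg : ∀ i, ∀ n ∈ A i, ε ≤ g i n) :
    ε ^ 3 * ((∑ n ∈ (A 2).image (N - ·), rep (A 0) (A 1) n : ℕ) : ℝ) ≤ tripleSum N S g := by
  have h1 : ((∑ n ∈ (A 2).image (N - ·), rep (A 0) (A 1) n : ℕ) : ℝ) =
      ∑ x ∈ A 0, ∑ y ∈ A 1, ∑ z ∈ A 2, if x + y + z = N then 1 else 0 := by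
    rw [sum_image sub_right_injective.injOn, sum_congr rfl fun x _ => sum_comm, sum_comm]
    push_cast
    refine sum_congr rfl fun z _ => ?_
    rw [rep, card_filter]
    push_cast
    refine sum_congr rfl fun x _ => ?_
    have : ∀ y, (x + y + z = N) ↔ (N - z - x = y) := fun y => by omega
    simp_rw [this]
    rw [sum_ite_eq]
  have hnn : ∀ x y z, 0 ≤ if x + y + z = N then g 0 x * g 1 y * g 2 z else 0 := fun x y z => by
    have := hg 0 x
    have := hg 1 y
    have := hg 2 z
    split_ifs <;> positivity
  rw [h1, tripleSum]
  simp_rw [mul_sum]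
  refine (sum_le_sum fun x hx => ?_).trans (sum_le_sum_of_subset_of_nonneg (hA 0) fun x _ _ =>
    sum_nonneg fun y _ => sum_nonneg fun z _ => hnn x y z)
  refine (sum_le_sum fun y hy => ?_).trans (sum_le_sum_of_subset_of_nonneg (hA 1) fun y _ _ =>
    sum_nonneg fun z _ => hnn x y z)
  refine (sum_le_sum fun z hz => ?_).trans (sum_le_sum_of_subset_of_nonneg (hA 2) fun z _ _ =>
    hnn x y z)
  split_ifs
  · rw [mul_one, pow_three']
    have := hAg 0 x hx
    have := hAg 1 y hy
    have := hAg 2 z hz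
    have := hg 0 x
    have := hg 1 y
    gcongr
  · rw [mul_zero]

/-! ### The density threshold and the main theorem -/

/-- For equal averages the left branch of the mean condition is at most `5α/2`, whence `2/5`.
Conversely, `α - 2/5` serves when `2α ≤ 1`, and the cap `1/5` covers the branch where the minimum is
`1`. -/
lemma exists_meanCondition_iff (α : ℝ) :
    (∃ δ : ℝ, 0 < δ ∧ δ < 1 ∧ MeanCondition δ (fun _ => α)) ↔ 2 / 5 < α := by
  constructor
  · rintro ⟨δ, h0, -, -, h⟩
    simp only at h
    linarith [min_le_right 1 (α + α)]
  · intro h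
    refine ⟨min (1 / 5) (α - 2 / 5), lt_min (by norm_num) (by linarith),
      (min_le_left _ _).trans_lt (by norm_num), fun _ => (min_le_right _ _).trans (by linarith), ?_⟩
    have h1 := min_le_left (1 / 5) (α - 2 / 5)
    have h2 := min_le_right (1 / 5) (α - 2 / 5)
    simp only
    rcases min_cases 1 (α + α) with ⟨e, _⟩ | ⟨e, _⟩ <;> rw [e] <;> linarith

end Transference

open Finset Transference in
theorem mainTheorem2 :
    (∀ δ κ : ℝ, 0 < δ → δ < 1 → 0 < κ → κ < 1 →
      ∃ c : ℝ, 0 < c ∧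
        ∀ q K : Fin 3 → ℝ, (∀ i, 2 < q i ∧ q i < 3) →
          ∃ η₀ : ℝ, 0 < η₀ ∧ ∃ N₀ : ℕ,
            ∀ η : ℝ, 0 < η → η ≤ η₀ → ∀ N : ℕ, N₀ ≤ N →
              ∀ ν a : Fin 3 → ℕ → ℝ,
                (∀ i, ∀ n ∈ Finset.Icc 1 (Transference.len N i), 0 ≤ a i n ∧ a i n ≤ ν i n) →
                Transference.MeanCondition δ
                  (fun i => Transference.mean (Transference.len N i) (a i)) →
                (∀ i, Transference.IsPseudorandom η (Transference.len N i) (ν i)) →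
                (∀ i, Transference.LqExtension (q i) (K i) (Transference.len N i) (a i)) →
                Transference.IsRegular (δ / 50) κ (Transference.len N 0) (a 0) →
                c * (N : ℝ) ^ 2 ≤ Transference.solutionSum N a) ∧
    (∀ α : ℝ,
      (∃ δ : ℝ, 0 < δ ∧ δ < 1 ∧ Transference.MeanCondition δ (fun _ => α)) ↔ 2 / 5 < α) := by
  refine ⟨fun δ κ hδ hδ1 hκ _ => ?_, exists_meanCondition_iff⟩
  set Q := primeProd (δ / 50)⁻¹ with hQ
  have hQ0 : 0 < Q := primorial_pos _
  have hQ0' : (0 : ℝ) < Q := by exact_mod_cast hQ0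
  set κ' : ℝ := κ / (2 * (Q : ℝ) ^ 2) with hκ'
  have hκ'0 : 0 < κ' := by positivity
  obtain ⟨c, hc, N₀, hdense⟩ := exists_le_sum_rep hδ hδ1 (by positivity : 0 < κ' / 6)
  -- The level-set loss `6ε` is then at most `δ / 1000` and at most half of `κ'`. The other half,
  -- with `N / 3 ≤ ⌊N/2⌋`, leaves the `κ' / 6` given to the dense case.
  set ε : ℝ := min (δ / 6000) (κ' / 12) with hε
  have hε0 : 0 < ε := by positivity
  have hεδ : ε ≤ δ / 6000 := min_le_left _ _
  have hεκ : ε ≤ κ' / 12 := min_le_right _ _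
  refine ⟨ε ^ 3 * c / 2, by positivity, fun q K hq => ?_⟩
  -- The counting lemma has two errors of at most `τ * N ^ 2` each, together half of the main term
  -- `ε ^ 3 * c * N ^ 2`.
  set τ : ℝ := ε ^ 3 * c / 4 with hτ
  have hτ0 : 0 < τ := by positivity
  set C : ℝ := ∑ i, 2 ^ (3 - q i) * |K i| ^ q i with hC
  have hCi : ∀ i, 0 ≤ (2 : ℝ) ^ (3 - q i) * |K i| ^ q i := fun i => by positivity
  have hC0 : 0 ≤ C := sum_nonneg fun i _ => hCi i
  set l : ℝ := min 1 (τ / (2 * (C + 1))) with hl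
  have hl0 : 0 < l := by positivity
  have hlC : 2 * l ^ 3 * C ≤ τ := by
    have h1 : l ^ 3 ≤ l := pow_le_of_le_one hl0.le (min_le_left _ _) (by norm_num)
    have h2 : l ≤ τ / (2 * (C + 1)) := min_le_right _ _
    rw [le_div_iff₀ (by positivity)] at h2
    have h3 := mul_le_mul_of_nonneg_right h1 hC0
    linarith
  -- The factor `l ^ 6` cancels the weight `(l ^ 6)⁻¹` in the counting lemma.
  have htrans := fun i => exists_smooth_third_moment (K := K i) hQ0 (hq i).1 (hq i).2
    (by positivity : 0 < τ * l ^ 6) hε0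
  choose η₀ hη₀ htrans using htrans
  refine ⟨min (η₀ 0) (min (η₀ 1) (η₀ 2)), lt_min (hη₀ 0) (lt_min (hη₀ 1) (hη₀ 2)), max N₀ 2, ?_⟩
  intro η hη hη' N hN ν a ha hmean hν hL hreg
  have hη₀i : ∀ i, η ≤ η₀ i := by
    intro i
    fin_cases i
    · exact hη'.trans (min_le_left _ _)
    · exact hη'.trans ((min_le_right _ _).trans (min_le_left _ _))
    · exact hη'.trans ((min_le_right _ _).trans (min_le_right _ _))
  have hN2 : 2 ≤ N := (le_max_right _ _).trans hN
  have hlen : ∀ i, len N i ≠ 0 := by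
    intro i
    fin_cases i <;> simp [len] <;> omega
  have hlenN : ∀ i, (len N i : ℝ) ≤ N := by
    intro i
    have : len N i ≤ N := by fin_cases i <;> simp [len] <;> omega
    exact_mod_cast this
  have hlen0 : ∀ i, (0 : ℝ) < len N i := fun i => by exact_mod_cast Nat.pos_of_ne_zero (hlen i)
  have hN6 : (N : ℝ) / 3 ≤ (N / 2 : ℕ) := by
    have : N ≤ 3 * (N / 2) := by omega
    have : (N : ℝ) ≤ 3 * (N / 2 : ℕ) := by exact_mod_cast this
    linarith
  choose B hB1 hB2 hB3 hB4 hB5 hB6 hB7 using fun i =>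
    htrans i η hη (hη₀i i) (len N i) (hlen i) (ν i) (a i) (ha i) (hν i) (hL i)
  have hsq : ∀ i, (len N i : ℝ) ^ 2 ≤ (N : ℝ) ^ 2 := fun i =>
    pow_le_pow_left₀ (by positivity) (hlenN i) 2
  set f : Fin 3 → ℤ → ℝ := fun i => ext (len N i) (a i) with hf
  set w : Fin 3 → ℕ := fun i => ⌊ε * len N i⌋₊ with hw
  have hwle : ∀ i, (w i : ℝ) ≤ ε * len N i := fun i => Nat.floor_le (by positivity)
  set g : Fin 3 → ℤ → ℝ := fun i => smooth (B i) (f i) with hg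
  have hf0 : ∀ i n, 0 ≤ f i n := fun i => ext_nonneg fun n hn => (ha i n hn).1
  have hg0 : ∀ i n, 0 ≤ g i n := fun i => smooth_nonneg _ (hf0 i)
  have hcount := abs_tripleSum_smooth_sub_le (N := N) (n := len N) (w := w) (f := f) (B := B)
    hB2 (fun i x hx => ext_of_notMem hx _) hl0 (C := C * (N : ℝ) ^ 2) (c := τ * l ^ 6 * (N : ℝ) ^ 2)
    (fun i => (hB6 i).trans (mul_le_mul (single_le_sum (fun i _ => hCi i) (mem_univ i)) (hsq i)
      (by positivity) hC0))
    (fun i => (hB7 i).trans (mul_le_mul_of_nonneg_left (hsq i) (by positivity)))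
  have herr : 2 * l ^ 3 * (C * (N : ℝ) ^ 2) + (l ^ 6)⁻¹ * (τ * l ^ 6 * (N : ℝ) ^ 2) ≤
      2 * τ * (N : ℝ) ^ 2 := by
    have h1 := mul_le_mul_of_nonneg_right hlC (sq_nonneg (N : ℝ))
    have h2 : (l ^ 6)⁻¹ * (τ * l ^ 6 * (N : ℝ) ^ 2) = τ * (N : ℝ) ^ 2 := by field_simp
    linarith
  set A : Fin 3 → Finset ℤ := fun i =>
    {n ∈ Icc (1 - (w i : ℤ)) (len N i + w i) | n ∈ Icc (1 : ℤ) (len N i) ∧ ε ≤ g i n} with hA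
  have hε1 : ε ≤ 1 := by linarith
  have hAI : ∀ i, A i ⊆ Icc (1 : ℤ) (len N i) := fun i n hn => (mem_filter.1 hn).2.1
  have hshift : ∀ i, ∀ b ∈ B i, ∀ b' ∈ B i, |b - b'| ≤ (w i : ℤ) := by
    intro i b hb b' hb'
    have h1 := mem_Icc.1 (hB2 i hb)
    have h2 := mem_Icc.1 (hB2 i hb')
    exact abs_le.2 (by simp only [hw]; omega)
  have hmeanf : ∀ i, mean (len N i) (a i) * len N i = ∑ n ∈ Icc (1 : ℤ) (len N i), f i n := by
    intro i
    rw [mean, div_mul_cancel₀ _ (hlen0 i).ne', sum_Icc_intCast]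
    exact (sum_congr rfl fun n hn => ext_natCast hn (a i)).symm
  have hmean2 : ∀ i, mean (len N i) (a i) ≤ 2 := fun i => by
    refine le_of_mul_le_mul_right ?_ (hlen0 i)
    rw [hmeanf]; exact hB5 i
  have hε6 : ∀ i, 6 * ε * len N i ≤ δ / 1000 * N := fun i =>
    mul_le_mul (by linarith) (hlenN i) (by positivity) (by positivity)
  have hAcard : ∀ i, mean (len N i) (a i) * len N i - δ / 1000 * N ≤ #(A i) := by
    intro i
    refine le_trans ?_ (sum_sub_le_card_level hε0.le hε1 (hwle i) (hB4 i) Subset.rfl)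
    rw [hmeanf]
    refine sub_le_sub (sum_le_sum_smooth (hB1 i) (hf0 i) fun x hx b hb b' hb' => ?_) (hε6 i)
    have h1 := abs_le.1 (hshift i b hb b' hb')
    rw [mem_Icc] at hx ⊢
    omega
  obtain ⟨b₀, b₁, hgcd, hb₀, hb₁⟩ := exists_residues_of_isRegular hκ (hlen 0)
    (fun n hn => (ha 0 n hn).1) (hB5 0) hreg
  -- Smoothing only shifts by multiples of `Q`, so it preserves the mass in each residue class.
  have hdvd : ∀ b ∈ B 0, ∀ b' ∈ B 0, ∀ x : ℤ, x - (b - b') ≡ x [ZMOD Q] := fun b hb b' hb' x =>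
    (Int.modEq_iff_dvd.2 (by simpa using dvd_sub (hB3 0 b hb) (hB3 0 b' hb')))
  have hlen0' : len N 0 = N / 2 := rfl
  have hεw : (w 0 : ℝ) ≤ δ / 1000 * N := by
    have h1 := hε6 0
    have h2 := hwle 0
    have : 0 ≤ ε * len N 0 := by positivity
    linarith
  have hmass : ∀ m : ℝ, κ' * len N 0 ≤ m → κ' / 6 * N ≤ m - 6 * ε * len N 0 := by
    intro m hm
    have h1 : ε * len N 0 ≤ κ' / 12 * len N 0 := by gcongr
    have h2 : κ' / 2 * (N / 3) ≤ κ' / 2 * len N 0 := by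
      rw [hlen0']; gcongr
    linarith
  have key := hdense N ((le_max_left _ _).trans hN) _ hmean hmean2 (A 0) (A 1)
    ((A 2).image ((N : ℤ) - ·)) (hAI 0) (hAI 1) ?_ (hAcard 0) (hAcard 1) ?_ b₀ b₁ hgcd ?_ ?_
  · have h1 := mul_sum_rep_le_tripleSum (N := N) (S := fun i => Icc (1 - (w i : ℤ)) (len N i + w i))
      (A := A) hε0.le hg0 (fun i => filter_subset _ _) (fun i n hn => (mem_filter.1 hn).2.2)
    have h2 := mul_le_mul_of_nonneg_left key (by positivity : 0 ≤ ε ^ 3)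
    have h3 := (abs_le.1 (hcount.trans herr)).1
    rw [solutionSum_eq_tripleSum]
    change _ ≤ tripleSum N (fun i => Icc (1 : ℤ) (len N i)) f
    have h4 : ε ^ 3 * (c * (N : ℝ) ^ 2) = ε ^ 3 * c / 2 * (N : ℝ) ^ 2 + 2 * τ * (N : ℝ) ^ 2 := by
      rw [hτ]; ring
    linarith
  · intro n hn
    obtain ⟨z, hz, rfl⟩ := mem_image.1 hn
    have h1 := mem_Icc.1 (hAI 2 hz)
    have h2 : len N 2 = N := rfl
    rw [h2] at h1
    exact mem_Icc.2 (by omega)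
  · rw [card_image_of_injective _ sub_right_injective]
    exact hAcard 2
  · refine (hmass _ hb₀).trans ?_
    refine (sub_le_sub_right (sum_le_sum_smooth
      (X' := {n ∈ Icc (1 - (w 0 : ℤ)) (len N 0 + w 0) |
        ((n : ℤ) : ℝ) ≤ δ / 50 * len N 0 + w 0 ∧ n ≡ b₀ [ZMOD Q]}) (hB1 0) (hf0 0) ?_) _).trans
      ((sum_sub_le_card_level hε0.le hε1 (hwle 0) (hB4 0) (filter_subset _ _)).trans ?_)
    · intro x hx b hb b' hb'
      have h1 := abs_le.1 (hshift 0 b hb b' hb')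
      simp only [mem_filter, mem_Icc] at hx ⊢
      refine ⟨by omega, ?_, (hdvd b hb b' hb' x).trans hx.2.2⟩
      have : ((x - (b - b') : ℤ) : ℝ) ≤ x + w 0 := by
        exact_mod_cast (by omega : x - (b - b') ≤ x + w 0)
      linarith [hx.2.1]
    · refine Nat.cast_le.2 (card_le_card fun n hn => ?_)
      simp only [mem_filter, hA] at hn ⊢
      refine ⟨⟨hn.1.1, hn.2⟩, ?_, hn.1.2.2⟩
      have := hn.1.2.1
      rw [hlen0'] at this
      linarith
  · refine (hmass _ hb₁).trans ?_
    refine (sub_le_sub_right (sum_le_sum_smooth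
      (X' := {n ∈ Icc (1 - (w 0 : ℤ)) (len N 0 + w 0) |
        (1 - δ / 50) * len N 0 - w 0 ≤ ((n : ℤ) : ℝ) ∧ n ≡ b₁ [ZMOD Q]}) (hB1 0) (hf0 0) ?_) _).trans
      ((sum_sub_le_card_level hε0.le hε1 (hwle 0) (hB4 0) (filter_subset _ _)).trans ?_)
    · intro x hx b hb b' hb'
      have h1 := abs_le.1 (hshift 0 b hb b' hb')
      simp only [mem_filter, mem_Icc] at hx ⊢
      refine ⟨by omega, ?_, (hdvd b hb b' hb' x).trans hx.2.2⟩
      have : (x : ℝ) - w 0 ≤ ((x - (b - b') : ℤ) : ℝ) := by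
        exact_mod_cast (by omega : x - w 0 ≤ x - (b - b'))
      linarith [hx.2.1]
    · refine Nat.cast_le.2 (card_le_card fun n hn => ?_)
      simp only [mem_filter, hA] at hn ⊢
      refine ⟨⟨hn.1.1, hn.2⟩, ?_, hn.1.2.2⟩
      have := hn.1.2.1
      rw [hlen0'] at this
      linarith
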